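/- Let $K\ge 2$, $\sigma>0$, $c>0$ and $B\in\mathbb R$. A $K$-armed model is a tuple $\nu=(\nu_a)_{a\in[K]}$ of probability distributions on $\mathbb R$ with finite means $\mu_a$. Let $G_\sigma$ be the set of distributions of integrable variables $X$ with $\mathbb P(X-\mathbb E X>t)\le e^{-t^2/(2\sigma^2)}$ for all $t>0$, and let $\mathcal M=\{\nu:\ \nu_a\in G_\sigma,\ \mu_a\in[0,B]\ \text{for all } a\}$. Let $0=\Delta_1(\nu)\le\Delta_2(\nu)\le\dots\le\Delta_K(\nu)$ be the gaps $\max_b\mu_b-\mu_a$ in increasing order, $\mathcal H(\nu)=\sum_{k=2}^K\Delta_k(\nu)^{-2}\in(0,\infty]$, and $\mathcal M_H=\{\nu\in\mathcal M:\mathcal H(\nu)\le H\}$. A (possibly randomized) policy $\pi$ decides in every round, on the basis of the past arms and rewards, either to pull an arm $a$, in which case it observes an independent sample of $\nu_a$, or to stop and recommend an arm $\hat I$. Let $\tau\in\{0,1,\dots,\infty\}$ be the number of pulls before it stops, and let $\mathcal R_2(\pi,\nu)=\mathbb E_{\nu,\pi}\big[(\max_b\mu_b-\mu_{\hat I})+c\tau\big]\in[0,\infty]$.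 For $H>0$ and $\Delta_2\ge0$ put $$h(H,\Delta_2)=\begin{cases}\dfrac{c\sigma^2H}{4}\log\Big(\dfrac{e\Delta_2}{\sigma^2cH}\Big)&\text{if } H\Delta_2^{-1}\le(\sigma^2c)^{-1},\\[2mm] \Delta_2/4&\text{if } H\Delta_2^{-1}>(\sigma^2c)^{-1},\end{cases}$$ where $H\cdot 0^{-1}=\infty$. Then the following hold. 1. Let $H>0$ and $\Delta_2\ge0$ satisfy $\Delta_2\le\sqrt{(K-1)/H}$ and $2\sqrt{(K-1)/H}\le B$. Then for every policy $\pi$, $$\sup_{\nu\in\mathcal M_H}\mathcal R_2(\pi,\nu)\ \ge\ h(H,\Delta_2).$$ 2. Let $H>0$ and $\Delta_2\ge0$ be such that some $\nu_0\in\mathcal M$ has $\mathcal H(\nu_0)=H$ and $\Delta_2(\nu_0)=\Delta_2$, and let $2\sqrt{(K-1)/H}\le B$. Then for every policy $\pi$ the same bound holds over the models with smallest gap $\Delta_2$: $$\sup_{\nu\in\mathcal M_H,\ \Delta_2(\nu)=\Delta_2}\mathcal R_2(\pi,\nu)\ \ge\ h(H,\Delta_2).$$ 3. If $2\big(\sqrt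 e\,(K-1)\sigma^2c\big)^{1/3}\le B$, then for every policy $\pi$, $$\sup_{\nu\in\mathcal M}\mathcal R_2(\pi,\nu)\ \ge\ \frac38\Big(\frac{(K-1)\sigma^2c}{e}\Big)^{1/3}.$$ -/

import Mathlib

open MeasureTheory ProbabilityTheory
open scoped ENNReal

noncomputable section

namespace BanditRisk

/-! ### Bandit models -/

/-- A `K`-armed bandit model: one reward distribution per arm. The arms are not assumed to be
listed in decreasing order of their means, since the learner does not know that order. -/
abbrev Model (K : ℕ) : Type := Fin K → ProbabilityMeasure ℝ

/-- The mean of a distribution on `ℝ`. -/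
def mean (p : ProbabilityMeasure ℝ) : ℝ := ∫ x, x ∂(p : Measure ℝ)

/-- The class `G_σ` of `σ`-sub-Gaussian distributions (the mean being required to exist). -/
def SubGaussian (σ : ℝ) (p : ProbabilityMeasure ℝ) : Prop :=
  Integrable (fun x : ℝ => x) (p : Measure ℝ) ∧
    ∀ t : ℝ, 0 < t →
      (p : Measure ℝ) {x | t < x - mean p} ≤ ENNReal.ofReal (Real.exp (-(t ^ 2 / (2 * σ ^ 2))))

/-- The class `𝓜` of models with `σ`-sub-Gaussian arms and means in `[0, B]`. -/
def models (K : ℕ) (σ B : ℝ) : Set (Model K) :=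
  {ν | ∀ a, SubGaussian σ (ν a) ∧ mean (ν a) ∈ Set.Icc 0 B}

/-- Arm `a` has the largest mean. -/
def IsBest {K : ℕ} (ν : Model K) (a : Fin K) : Prop :=
  ∀ k, mean (ν k) ≤ mean (ν a)

/-- The sub-optimality gap of arm `k`: the largest mean minus the mean of arm `k`. -/
def gap {K : ℕ} (ν : Model K) (k : Fin K) : ℝ :=
  (⨆ a, mean (ν a)) - mean (ν k)

/-- The complexity `𝓗(ν) = ∑_{k ≥ 2} Δ_k⁻²`: the sum of the inverse squared gaps over all arms but
one best arm (all best arms give the same value). A vanishing gap contributes `∞`. -/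
def complexity {K : ℕ} (ν : Model K) : ℝ≥0∞ :=
  ⨅ (a : Fin K) (_ : IsBest ν a), ∑ k ∈ Finset.univ.erase a, (ENNReal.ofReal (gap ν k) ^ 2)⁻¹

/-- The smallest gap `Δ₂(ν)`: the smallest gap over all arms but one best arm (all best arms give
the same value; it is `0` if there are several). -/
def smallestGap {K : ℕ} (ν : Model K) : ℝ≥0∞ :=
  ⨅ (a : Fin K) (_ : IsBest ν a), ⨅ k ∈ Finset.univ.erase a, ENNReal.ofReal (gap ν k)

/-- The class `𝓜_H` of models with complexity at most `H`. -/
def modelsOfComplexity (K : ℕ) (σ B H : ℝ) : Set (Model K) :=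
  {ν | ν ∈ models K σ B ∧ complexity ν ≤ ENNReal.ofReal H}

/-! ### Policies -/

/-- In each round, a policy either pulls an arm or stops and recommends an arm. -/
inductive Decision (K : ℕ) : Type
  | pull (a : Fin K) : Decision K
  | recommend (i : Fin K) : Decision K

instance (K : ℕ) : MeasurableSpace (Decision K) := ⊤

/-- The record of one round: the decision and the observed reward (`0` if no arm was pulled). -/
abbrev Round (K : ℕ) : Type := Decision K × ℝ

/-- A (randomized) policy: a law for the first decision and, for every `n`, a Markov kernel giving
the law of the next decision from the record of the rounds `0, …, n`. -/
structure Policy (K : ℕ) where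
  first : Measure (Decision K)
  next : (n : ℕ) → Kernel ((i : Finset.Iic n) → Round K) (Decision K)
  isProbabilityMeasure_first : IsProbabilityMeasure first
  isMarkovKernel_next : ∀ n, IsMarkovKernel (next n)

instance {K : ℕ} (π : Policy K) : IsProbabilityMeasure π.first := π.isProbabilityMeasure_first

instance {K : ℕ} (π : Policy K) (n : ℕ) : IsMarkovKernel (π.next n) := π.isMarkovKernel_next n

/-- The law of the reward observed after a decision. -/
def rewardLaw {K : ℕ} (ν : Model K) : Decision K → Measure ℝ
  | .pull a => (ν a : Measure ℝ)
  | .recommend _ => Measure.dirac 0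

/-- `rewardLaw` as a kernel. -/
def rewardKernel {K : ℕ} (ν : Model K) : Kernel (Decision K) ℝ where
  toFun := rewardLaw ν
  measurable' := measurable_from_top

instance {K : ℕ} (ν : Model K) : IsMarkovKernel (rewardKernel ν) := by
  constructor
  rintro (a | i)
  · exact (ν a).2
  · exact Measure.dirac.isProbabilityMeasure

/-- The conditional law of round `n + 1` given the rounds `0, …, n`: the policy draws a decision
from the past, then the reward is drawn given the decision only. -/
def roundKernel {K : ℕ} (π : Policy K) (ν : Model K) (n : ℕ) :
    Kernel ((i : Finset.Iic n) → Round K) (Round K) :=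
  π.next n ⊗ₖ Kernel.prodMkLeft _ (rewardKernel ν)

instance {K : ℕ} (π : Policy K) (ν : Model K) (n : ℕ) : IsMarkovKernel (roundKernel π ν n) := by
  unfold roundKernel; infer_instance

/-- The law `ℙ_{ν,π}` of the interaction of the policy `π` with the model `ν`. Rounds after the
first `recommend` decision are part of the probability space but play no role in the risk. -/
def law {K : ℕ} (π : Policy K) (ν : Model K) : Measure (ℕ → Round K) :=
  Kernel.trajMeasure (X := fun _ => Round K) (π.first ⊗ₘ rewardKernel ν) (roundKernel π ν)

/-! ### Stopping time, recommendation, risk -/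

/-- In round `t` of the interaction `ω` the policy decides to stop. -/
def StopsAt {K : ℕ} (ω : ℕ → Round K) (t : ℕ) : Prop :=
  ∃ i, (ω t).1 = Decision.recommend i

open Classical in
/-- The stopping time `τ`, the total number of pulls before the policy stops; `∞` if it never
stops. As rounds are numbered from `0`, this is the first round with a `recommend` decision. -/
def stoppingTime {K : ℕ} (ω : ℕ → Round K) : ℝ≥0∞ :=
  if h : ∃ t, StopsAt ω t then (Nat.find h : ℝ≥0∞) else ∞

open Classical in
/-- The simple regret `μ₁ - μ_{Î}` of the arm `Î` recommended at the stopping time. If the policy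
never stops, there is no recommendation and the value is immaterial, as then `τ = ∞`. -/
def regret {K : ℕ} (ν : Model K) (ω : ℕ → Round K) : ℝ≥0∞ :=
  if h : ∃ t, StopsAt ω t then
    match (ω (Nat.find h)).1 with
    | .recommend i => ENNReal.ofReal (gap ν i)
    | .pull _ => 0
  else 0

/-- The risk `R₂(π, ν) = 𝔼_{ν,π}[(μ₁ - μ_{Î}) + c τ]`, a value in `[0, ∞]`. -/
def risk {K : ℕ} (c : ℝ) (π : Policy K) (ν : Model K) : ℝ≥0∞ :=
  ∫⁻ ω, (regret ν ω + ENNReal.ofReal c * stoppingTime ω) ∂(law π ν)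

/-! ### The lower bound -/

/-- The gap-dependent lower bound. The condition `σ² c H ≤ Δ₂` is `H Δ₂⁻¹ ≤ (σ² c)⁻¹`, with
`H Δ₂⁻¹ = ∞` for `Δ₂ = 0`. -/
def hardness (σ c H Δ₂ : ℝ) : ℝ :=
  if σ ^ 2 * c * H ≤ Δ₂ then
    c * σ ^ 2 * H / 4 * Real.log (Real.exp 1 * Δ₂ / (σ ^ 2 * c * H))
  else Δ₂ / 4

end BanditRisk

end

/-! Two-point method with Gaussian arms of variance σ². Suppose that the risk is at most R on the
class. Take a base model with best arm i and an alternative with best arm j ≠ i, every other arm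
losing at least Δ in either model. No recommendation is right in both, so the Bretagnolle–Huber
inequality (`exp_neg_le_law_recommendsBefore`) forces errors. With n_a the expected number of pulls
of arm a under the base model, s = ∑ n_a and κ = ∑ n_a (μ'_a - μ_a)² / (2σ²), adding the two risks
gives (Δ/2) exp(-κ) + c s ≤ 2R. As τ may be infinite, everything is first cut off at round N. The
policy is still running then with probability at most R/(cN), which vanishes in the limit
(`two_point_bound`).

If the alternative raises the single arm j to the height `top`, then κ = n_j (top - μ_j)² / (2σ²).
When ∑_{j ≠ i} (top - μ_j)⁻² ≥ H/4, a pigeonhole argument finds an arm j, depending on the policy,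
with κ ≤ 2s/(Hσ²). Minimizing c s + (Δ/2) exp(-2s/(Hσ²)) over s ≥ 0 yields exactly 2h(H, Δ)
(`two_mul_hardness_le`).

It remains to place the means. Let D = √((K-1)/H). Without a constraint on the smallest gap, one arm
at D and the others at 0 will do, an arm being raised to 2D. With smallest gap Δ and HΔ² ≥ 4, two
arms sit at 2D - Δ and 2D - 2Δ, the others at 0, and again an arm is raised to 2D. If HΔ² ≤ 4,
exchanging the two best arms is already hard to detect. The minimax bound is the first one with Δ =
D and the best choice of D. -/

noncomputable section

namespace BanditRisk

open Finset Preorder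
open scoped NNReal

variable {K : ℕ}

/-! ### The law of the interaction, round by round -/

instance (π : Policy K) (ν : Model K) : IsProbabilityMeasure (law π ν) := by
  unfold law; infer_instance

lemma map_law_zero (π : Policy K) (ν : Model K) :
    (law π ν).map (fun ω => ω 0) = π.first ⊗ₘ rewardKernel ν := by
  have h : (fun ω : ℕ → Round K => ω 0) =
      (MeasurableEquiv.piUnique (fun _ : Iic 0 => Round K)) ∘
        frestrictLe (π := fun _ => Round K) 0 := by
    ext ω <;> rfl
  rw [h, ← Measure.map_map (by fun_prop) (by fun_prop), law, Kernel.trajMeasure,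
    Measure.map_comp _ _ (by fun_prop), Kernel.traj_map_frestrictLe, Kernel.partialTraj_self,
    Measure.id_comp]
  exact (MeasurableEquiv.map_map_symm _)

lemma map_law_succ (π : Policy K) (ν : Model K) (n : ℕ) :
    (law π ν).map (fun ω => (frestrictLe n ω, ω (n + 1))) =
      (law π ν).map (frestrictLe n) ⊗ₘ roundKernel π ν n :=
  Kernel.map_frestrictLe_trajMeasure_compProd_eq_map_trajMeasure.symm

lemma lintegral_law_zero (π : Policy K) (ν : Model K) {f : Round K → ℝ≥0∞} (hf : Measurable f) :
    ∫⁻ ω, f (ω 0) ∂law π ν = ∫⁻ d, ∫⁻ x, f (d, x) ∂rewardLaw ν d ∂π.first := by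
  rw [← lintegral_map (μ := law π ν) (g := fun ω => ω 0) hf (by fun_prop), map_law_zero,
    Measure.lintegral_compProd hf]
  rfl

lemma lintegral_roundKernel (π : Policy K) (ν : Model K) (n : ℕ) (h : (i : Iic n) → Round K)
    {f : Round K → ℝ≥0∞} (hf : Measurable f) :
    ∫⁻ y, f y ∂roundKernel π ν n h = ∫⁻ d, ∫⁻ x, f (d, x) ∂rewardLaw ν d ∂π.next n h := by
  rw [roundKernel, Kernel.lintegral_compProd _ _ _ hf]
  rfl

lemma lintegral_law_succ (π : Policy K) (ν : Model K) (n : ℕ)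
    {f : ((i : Iic n) → Round K) × Round K → ℝ≥0∞} (hf : Measurable f) :
    ∫⁻ ω, f (frestrictLe n ω, ω (n + 1)) ∂law π ν =
      ∫⁻ ω, ∫⁻ y, f (frestrictLe n ω, y) ∂roundKernel π ν n (frestrictLe n ω) ∂law π ν := by
  rw [← lintegral_map (μ := law π ν) (g := fun ω => (frestrictLe n ω, ω (n + 1))) hf
    (by fun_prop), map_law_succ, Measure.lintegral_compProd hf,
    lintegral_map (hf.lintegral_kernel_prod_right') (by fun_prop)]

/-- The history extended by one round. -/
def extendHistory (n : ℕ) (p : ((i : Iic n) → Round K) × Round K) : (i : Iic (n + 1)) → Round K :=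
  fun i => if h : i.1 ≤ n then p.1 ⟨i.1, mem_Iic.2 h⟩ else p.2

lemma measurable_extendHistory (n : ℕ) : Measurable (extendHistory (K := K) n) := by
  refine measurable_pi_lambda _ fun i => ?_
  unfold extendHistory
  split_ifs <;> fun_prop

lemma extendHistory_frestrictLe (n : ℕ) (ω : ℕ → Round K) :
    extendHistory n (frestrictLe n ω, ω (n + 1)) = frestrictLe (n + 1) ω := by
  ext1 i
  unfold extendHistory
  split_ifs with h
  · rfl
  · have : i.1 = n + 1 := le_antisymm (mem_Iic.1 i.2) (by omega)
    simp [frestrictLe, this]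

/-- Change of model: if the reward laws of `ν'` have the density `ρ` with respect to those of `ν`,
then the laws of the histories have the product of the `ρ`'s as a density. -/
lemma lintegral_law_withDensity (π : Policy K) {ν ν' : Model K} {ρ : Round K → ℝ≥0∞}
    (hρ : Measurable ρ)
    (h : ∀ d, rewardLaw ν' d = (rewardLaw ν d).withDensity fun x => ρ (d, x)) (n : ℕ)
    {g : ((i : Iic n) → Round K) → ℝ≥0∞} (hg : Measurable g) :
    ∫⁻ ω, g (frestrictLe n ω) ∂law π ν' =
      ∫⁻ ω, (∏ t ∈ range (n + 1), ρ (ω t)) * g (frestrictLe n ω) ∂law π ν := by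
  -- The decisions have the same conditional law in both models, so only the rewards contribute to
  -- the density.
  have key (d : Decision K) {f : Round K → ℝ≥0∞} (hf : Measurable f) :
      ∫⁻ x, f (d, x) ∂rewardLaw ν' d = ∫⁻ x, ρ (d, x) * f (d, x) ∂rewardLaw ν d := by
    rw [h, lintegral_withDensity_eq_lintegral_mul _ (by fun_prop) (by fun_prop)]
    rfl
  induction n with
  | zero =>
    have e (ω : ℕ → Round K) : frestrictLe (π := fun _ => Round K) 0 ω = fun _ => ω 0 := by
      ext1 i
      have : i.1 = 0 := Nat.le_zero.1 (mem_Iic.1 i.2)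
      simp [frestrictLe, this]
    have hg' : Measurable fun y : Round K => g fun _ => y :=
      hg.comp (measurable_pi_lambda _ fun _ => measurable_id)
    simp only [e, zero_add, range_one, prod_singleton]
    rw [lintegral_law_zero π ν' (f := fun y => g fun _ => y) hg',
      lintegral_law_zero π ν (f := fun y => ρ y * g fun _ => y) (hρ.mul hg')]
    exact lintegral_congr fun d => key d hg'
  | succ n ih =>
    have hG : Measurable fun p => g (extendHistory n p) := hg.comp (measurable_extendHistory n)
    have hL (ω : ℕ → Round K) :
        ∏ t ∈ range (n + 1), ρ (ω t) = ∏ i : Iic n, ρ (frestrictLe n ω i) := by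
      refine Eq.trans ?_ (prod_coe_sort (Iic n) fun t => ρ (ω t)).symm
      exact prod_congr (by ext; simp) fun _ _ => rfl
    have hmL : Measurable fun y : (i : Iic n) → Round K => ∏ i : Iic n, ρ (y i) := by fun_prop
    simp only [← extendHistory_frestrictLe]
    rw [lintegral_law_succ π ν' n hG]
    have hstep (y : (i : Iic n) → Round K) :
        ∫⁻ r, g (extendHistory n (y, r)) ∂roundKernel π ν' n y =
          ∫⁻ r, ρ r * g (extendHistory n (y, r)) ∂roundKernel π ν n y := by
      have h1 : Measurable fun r => g (extendHistory n (y, r)) := hG.comp measurable_prodMk_left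
      rw [lintegral_roundKernel _ _ _ _ h1, 
        lintegral_roundKernel _ _ _ _ (f := fun r => ρ r * g (extendHistory n (y, r)))
          (hρ.mul h1)]
      exact lintegral_congr fun d => key d h1
    simp only [hstep]
    have hm : Measurable fun p : ((i : Iic n) → Round K) × Round K =>
        ρ p.2 * g (extendHistory n p) := (hρ.comp measurable_snd).mul hG
    rw [ih (g := fun y => ∫⁻ r, ρ r * g (extendHistory n (y, r)) ∂roundKernel π ν n y)
      (hm.lintegral_kernel_prod_right')]
    simp_rw [prod_range_succ _ (n + 1), hL, mul_assoc]
    rw [lintegral_law_succ π ν n (f := fun p => (∏ i : Iic n, ρ (p.1 i)) *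
      (ρ p.2 * g (extendHistory n p))) ((hmL.comp measurable_fst).mul hm)]
    refine lintegral_congr fun ω => ?_
    exact (lintegral_const_mul _ (hm.comp measurable_prodMk_left)).symm

/-! ### Events before the stopping time -/

/-- The policy has not stopped in the rounds before `t`. -/
def running (K t : ℕ) : Set (ℕ → Round K) := {ω | ∀ s < t, ¬ StopsAt ω s}

/-- The policy has not stopped before round `t`, in which it pulls arm `a`. -/
def pullsAt (t : ℕ) (a : Fin K) : Set (ℕ → Round K) :=
  running K t ∩ {ω | (ω t).1 = .pull a}

/-- The policy stops in round `t` and recommends arm `i`. -/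
def recommendsAt (t : ℕ) (i : Fin K) : Set (ℕ → Round K) :=
  running K t ∩ {ω | (ω t).1 = .recommend i}

/-- The policy stops in one of the rounds before `N` and recommends arm `i`. -/
def recommendsBefore (N : ℕ) (i : Fin K) : Set (ℕ → Round K) :=
  ⋃ t ∈ range N, recommendsAt t i

lemma measurableSet_decision (t : ℕ) (s : Set (Decision K)) :
    MeasurableSet {ω : ℕ → Round K | (ω t).1 ∈ s} :=
  (measurable_fst.comp (measurable_pi_apply t)) (MeasurableSpace.measurableSet_top (s := s))

lemma measurableSet_running (t : ℕ) : MeasurableSet (running K t) := by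
  have : running K t = ⋂ s ∈ range t, {ω | (ω s).1 ∈ {d | ¬ ∃ i, d = Decision.recommend i}} := by
    ext ω; simp [running, StopsAt]
  rw [this]
  exact Finset.measurableSet_biInter _ fun s _ => measurableSet_decision s _

lemma measurableSet_pullsAt (t : ℕ) (a : Fin K) : MeasurableSet (pullsAt t a) :=
  (measurableSet_running t).inter (measurableSet_decision t {.pull a})

lemma measurableSet_recommendsAt (t : ℕ) (i : Fin K) : MeasurableSet (recommendsAt t i) :=
  (measurableSet_running t).inter (measurableSet_decision t {.recommend i})

lemma measurableSet_recommendsBefore (N : ℕ) (i : Fin K) :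
    MeasurableSet (recommendsBefore N i) :=
  Finset.measurableSet_biUnion _ fun t _ => measurableSet_recommendsAt t i

lemma running_antitone : Antitone (running K) := fun _ _ h _ hω s hs => hω s (hs.trans_le h)

lemma running_congr {t : ℕ} {ω ω' : ℕ → Round K} (h : ∀ s < t, ω s = ω' s) :
    ω ∈ running K t ↔ ω' ∈ running K t := by
  unfold running StopsAt
  exact forall₂_congr fun s hs => by rw [h s hs]

lemma mem_running_succ {t : ℕ} {ω : ℕ → Round K} :
    ω ∈ running K (t + 1) ↔ ∃ a, ω ∈ pullsAt t a := by
  constructor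
  · intro h
    cases hd : (ω t).1 with
    | pull a => exact ⟨a, fun s hs => h s (by omega), hd⟩
    | recommend i => exact absurd ⟨i, hd⟩ (h t (by omega))
  · rintro ⟨a, h, hd⟩ s hs
    rcases Nat.lt_succ_iff_lt_or_eq.1 hs with hs | rfl
    · exact h s hs
    · rintro ⟨i, hi⟩
      simp [hi] at hd

lemma not_mem_running_of_recommendsAt {t N : ℕ} {i : Fin K} {ω : ℕ → Round K} (htN : t < N)
    (h : ω ∈ recommendsAt t i) : ω ∉ running K N := fun hN => hN t htN ⟨i, h.2⟩

lemma eq_of_mem_recommendsAt {s t : ℕ} {i j : Fin K} {ω : ℕ → Round K}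
    (hs : ω ∈ recommendsAt s i) (ht : ω ∈ recommendsAt t j) : s = t := by
  by_contra hne
  rcases lt_or_gt_of_ne hne with h | h
  · exact not_mem_running_of_recommendsAt h hs ht.1
  · exact not_mem_running_of_recommendsAt h ht hs.1

lemma mem_running_or_mem_recommendsBefore (N : ℕ) (ω : ℕ → Round K) :
    ω ∈ running K N ∨ ∃ i, ω ∈ recommendsBefore N i := by
  induction N with
  | zero => exact .inl fun s hs => absurd hs (by omega)
  | succ N ih =>
    rcases ih with h | ⟨i, h⟩
    · cases hd : (ω N).1 with
      | pull a => exact .inl (mem_running_succ.2 ⟨a, h, hd⟩)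
      | recommend i =>
        exact .inr ⟨i, Set.mem_biUnion (Finset.mem_coe.2 (self_mem_range_succ N)) ⟨h, hd⟩⟩
    · refine .inr ⟨i, ?_⟩
      exact Set.biUnion_subset_biUnion_left (fun t ht => by simp at *; omega) h

/-! ### Change of model and law of the rewards -/

/-- A trajectory with the given history. -/
def pad (n : ℕ) (h : (i : Iic n) → Round K) (t : ℕ) : Round K :=
  h ⟨min t n, mem_Iic.2 (min_le_right _ _)⟩

lemma measurable_pad (n : ℕ) : Measurable (pad (K := K) n) :=
  measurable_pi_lambda _ fun _ => measurable_pi_apply _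

lemma pad_frestrictLe {n t : ℕ} (ht : t ≤ n) (ω : ℕ → Round K) :
    pad n (frestrictLe n ω) t = ω t := by
  simp [pad, frestrictLe, ht]

/-- Change of model for a function of the rounds before `N`. -/
lemma lintegral_law_change (π : Policy K) {ν ν' : Model K} {ρ : Round K → ℝ≥0∞}
    (hρ : Measurable ρ)
    (h : ∀ d, rewardLaw ν' d = (rewardLaw ν d).withDensity fun x => ρ (d, x)) (N : ℕ)
    {f : (ℕ → Round K) → ℝ≥0∞} (hf : Measurable f)
    (hfN : ∀ ω ω', (∀ t < N, ω t = ω' t) → f ω = f ω') :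
    ∫⁻ ω, f ω ∂law π ν' = ∫⁻ ω, (∏ t ∈ range N, ρ (ω t)) * f ω ∂law π ν := by
  cases N with
  | zero =>
    -- A function of no rounds is constant, and both laws have mass 1.
    obtain ⟨ω₀⟩ : Nonempty (ℕ → Round K) := (law π ν).nonempty_of_neZero
    have hc ω : f ω = f ω₀ := hfN _ _ fun t ht => absurd ht (by omega)
    simp [hc]
  | succ n =>
    have hg ω : f ω = f (pad n (frestrictLe n ω)) :=
      hfN _ _ fun t ht => (pad_frestrictLe (by omega) ω).symm
    have := lintegral_law_withDensity π hρ h n (hf.comp (measurable_pad n))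
    simpa only [Function.comp_apply, ← hg] using this

lemma lintegral_rewardLaw_pull (ν : Model K) (m : Measure (Decision K)) (a : Fin K) {s : Set ℝ}
    (hs : MeasurableSet s) :
    ∫⁻ d, ∫⁻ x, (({.pull a} : Set (Decision K)) ×ˢ s).indicator 1 (d, x) ∂rewardLaw ν d ∂m =
      m {.pull a} * (ν a : Measure ℝ) s := by
  have h (d : Decision K) :
      ∫⁻ x, (({.pull a} : Set (Decision K)) ×ˢ s).indicator (1 : Round K → ℝ≥0∞) (d, x)
        ∂rewardLaw ν d = ({.pull a} : Set (Decision K)).indicator (fun _ => (ν a : Measure ℝ) s) d := by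
    by_cases hd : d = .pull a
    · subst hd
      rw [Set.indicator_of_mem (Set.mem_singleton _), ← lintegral_indicator_one hs]
      refine lintegral_congr fun x => ?_
      by_cases hx : x ∈ s <;> simp [hx]
    · simp [hd]
  simp only [h]
  rw [lintegral_indicator (MeasurableSpace.measurableSet_top), setLIntegral_const, mul_comm]

/-- Given that arm `a` is pulled in round `t`, the reward of this round has law `ν a`. -/
lemma law_pullsAt_inter (π : Policy K) (ν : Model K) (t : ℕ) (a : Fin K) {s : Set ℝ}
    (hs : MeasurableSet s) :
    law π ν (pullsAt t a ∩ {ω | (ω t).2 ∈ s}) = law π ν (pullsAt t a) * (ν a : Measure ℝ) s := by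
  -- Proportionality to `ν a` suffices: the constant is then identified by `s = univ`.
  have key : ∃ C, ∀ s, MeasurableSet s →
      law π ν (pullsAt t a ∩ {ω | (ω t).2 ∈ s}) = C * (ν a : Measure ℝ) s := by
    classical
    have hms (s : Set ℝ) (hs : MeasurableSet s) :
        MeasurableSet (pullsAt t a ∩ {ω | (ω t).2 ∈ s}) :=
      (measurableSet_pullsAt t a).inter ((by fun_prop : Measurable fun ω : ℕ → Round K => (ω t).2) hs)
    have hmf (s : Set ℝ) (hs : MeasurableSet s) : Measurable
        ((({.pull a} : Set (Decision K)) ×ˢ s).indicator (1 : Round K → ℝ≥0∞)) :=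
      measurable_one.indicator (MeasurableSet.prod MeasurableSpace.measurableSet_top hs)
    cases t with
    | zero =>
      refine ⟨π.first {.pull a}, fun s hs => ?_⟩
      rw [← lintegral_rewardLaw_pull ν π.first a hs, ← lintegral_law_zero π ν (hmf s hs),
        ← lintegral_indicator_one (hms s hs)]
      refine lintegral_congr fun ω => ?_
      simp [Set.indicator_apply, pullsAt, running]
    | succ n =>
      -- Not having stopped before round n + 1 is an event of the history up to round n, hence
      -- independent of how that history is padded.
      set R : Set ((i : Iic n) → Round K) := pad n ⁻¹' running K (n + 1)
      have hR : MeasurableSet R := measurable_pad n (measurableSet_running _)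
      have hmem (ω : ℕ → Round K) : frestrictLe n ω ∈ R ↔ ω ∈ running K (n + 1) :=
        running_congr fun t ht => pad_frestrictLe (by omega) ω
      refine ⟨∫⁻ ω, R.indicator (fun _ => 1) (frestrictLe n ω) *
        π.next n (frestrictLe n ω) {.pull a} ∂law π ν,
        fun s hs => ?_⟩
      have hnext : Measurable fun ω : ℕ → Round K => π.next n (frestrictLe n ω) {.pull a} :=
        ((π.next n).measurable_coe MeasurableSpace.measurableSet_top).comp (measurable_frestrictLe n)
      have hRm : Measurable fun ω : ℕ → Round K => R.indicator (fun _ => (1 : ℝ≥0∞)) (frestrictLe n ω) :=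
        (measurable_const.indicator hR).comp (measurable_frestrictLe n)
      have hmul : Measurable fun ω : ℕ → Round K => R.indicator (fun _ => (1 : ℝ≥0∞))
          (frestrictLe n ω) * π.next n (frestrictLe n ω) {.pull a} := hRm.mul hnext
      rw [← lintegral_mul_const _ hmul, ← lintegral_indicator_one (hms s hs)]
      have h1 := lintegral_law_succ π ν n (f := fun p => R.indicator (fun _ => 1) p.1 *
        (({.pull a} : Set (Decision K)) ×ˢ s).indicator 1 p.2)
        (((measurable_const.indicator hR).comp measurable_fst).mul ((hmf s hs).comp measurable_snd))
      refine Eq.trans (lintegral_congr fun ω => ?_) (h1.trans (lintegral_congr fun ω => ?_))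
      · by_cases h : ω ∈ running K (n + 1) <;>
          simp [Set.indicator_apply, pullsAt, hmem, h]
      · simp only
        rw [lintegral_const_mul _ (hmf s hs), lintegral_roundKernel _ _ _ _ (hmf s hs),
          lintegral_rewardLaw_pull ν _ a hs, mul_assoc]
  obtain ⟨C, hC⟩ := key
  have h1 := hC Set.univ .univ
  simp only [Set.mem_univ, Set.ofPred_true, Set.inter_univ, measure_univ, mul_one] at h1
  rw [hC s hs, h1]

lemma map_restrict_pullsAt (π : Policy K) (ν : Model K) (t : ℕ) (a : Fin K) :
    ((law π ν).restrict (pullsAt t a)).map (fun ω => (ω t).2) =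
      law π ν (pullsAt t a) • (ν a : Measure ℝ) := by
  have hm : Measurable fun ω : ℕ → Round K => (ω t).2 := by fun_prop
  ext s hs
  rw [Measure.map_apply hm hs, Measure.restrict_apply (hm hs), Set.inter_comm]
  exact law_pullsAt_inter π ν t a hs

/-! ### Gaussian models and their likelihood ratios -/

/-- The model with Gaussian arms of means `μ a` and variance `v`. -/
def gaussianModel (μ : Fin K → ℝ) (v : ℝ≥0) : Model K :=
  fun a => ⟨gaussianReal (μ a) v, inferInstance⟩

/-- The log-likelihood ratio of two Gaussian models for a single round. -/
def logRatio (μ μ' : Fin K → ℝ) (v : ℝ≥0) : Round K → ℝ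
  | (.pull a, x) => ((μ' a - μ a) * (x - μ a) - (μ' a - μ a) ^ 2 / 2) / v
  | (.recommend _, _) => 0

instance : Countable (Decision K) := by
  refine Function.Injective.countable (β := Fin K ⊕ Fin K)
    (f := fun d => match d with | .pull a => .inl a | .recommend i => .inr i) ?_
  rintro (a | a) (b | b) h <;> simp_all

instance : MeasurableSingletonClass (Decision K) := ⟨fun _ => MeasurableSpace.measurableSet_top⟩

lemma measurable_logRatio (μ μ' : Fin K → ℝ) (v : ℝ≥0) : Measurable (logRatio μ μ' v) := by
  refine measurable_from_prod_countable_right fun d => ?_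
  cases d with
  | pull a => simp only [logRatio]; fun_prop
  | recommend i => exact measurable_const

lemma gaussianReal_eq_withDensity (m m' : ℝ) {v : ℝ≥0} (hv : v ≠ 0) :
    gaussianReal m' v = (gaussianReal m v).withDensity
      fun x => ENNReal.ofReal (Real.exp (((m' - m) * (x - m) - (m' - m) ^ 2 / 2) / v)) := by
  rw [gaussianReal_of_var_ne_zero m hv, gaussianReal_of_var_ne_zero m' hv,
    ← withDensity_mul _ (measurable_gaussianPDF m v) (by fun_prop)]
  congr 1
  ext x
  have hv' : (v : ℝ) ≠ 0 := by exact_mod_cast hv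
  rw [Pi.mul_apply, gaussianPDF, gaussianPDF, ← ENNReal.ofReal_mul (gaussianPDFReal_nonneg _ _ _),
    gaussianPDFReal, gaussianPDFReal, mul_assoc (√_)⁻¹, ← Real.exp_add]
  congr 3
  field_simp
  ring

lemma rewardLaw_gaussianModel (μ μ' : Fin K → ℝ) {v : ℝ≥0} (hv : v ≠ 0) (d : Decision K) :
    rewardLaw (gaussianModel μ' v) d = (rewardLaw (gaussianModel μ v) d).withDensity
      fun x => ENNReal.ofReal (Real.exp (logRatio μ μ' v (d, x))) := by
  cases d with
  | pull a => exact gaussianReal_eq_withDensity _ _ hv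
  | recommend i => simp [rewardLaw, logRatio]

/-- The log-likelihood ratio of two Gaussian models for the rounds before `N`, up to the stopping
time. -/
def stoppedLogRatio (μ μ' : Fin K → ℝ) (v : ℝ≥0) (N : ℕ) (ω : ℕ → Round K) : ℝ :=
  ∑ t ∈ range N, (running K t).indicator (fun ω => logRatio μ μ' v (ω t)) ω

lemma measurable_stoppedLogRatio (μ μ' : Fin K → ℝ) (v : ℝ≥0) (N : ℕ) :
    Measurable (stoppedLogRatio μ μ' v N) :=
  Finset.measurable_fun_sum _ fun t _ =>
    ((measurable_logRatio μ μ' v).comp (measurable_pi_apply t)).indicator (measurableSet_running t)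

/-- Round N itself still counts, because `running K N` only concerns the rounds before it. If the
policy stops in round N, that round contributes 0. -/
lemma stoppedLogRatio_eq_of_mem_running (μ μ' : Fin K → ℝ) (v : ℝ≥0) {N : ℕ} {ω : ℕ → Round K}
    (h : ω ∈ running K N) :
    stoppedLogRatio μ μ' v (N + 1) ω = ∑ t ∈ range (N + 1), logRatio μ μ' v (ω t) :=
  sum_congr rfl fun t ht => Set.indicator_of_mem
    (running_antitone (by simp at ht; omega : t ≤ N) h) _

lemma stoppedLogRatio_eq_of_notMem_running (μ μ' : Fin K → ℝ) (v : ℝ≥0) {M N : ℕ} (hMN : M ≤ N)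
    {ω : ℕ → Round K} (h : ω ∉ running K M) :
    stoppedLogRatio μ μ' v N ω = stoppedLogRatio μ μ' v M ω := by
  refine (sum_subset (by simpa using hMN) fun t _ ht => Set.indicator_of_notMem ?_ _).symm
  exact fun h' => h (running_antitone (by simpa using ht) h')

lemma ofReal_exp_sum (s : Finset ℕ) (f : ℕ → ℝ) :
    ∏ t ∈ s, ENNReal.ofReal (Real.exp (f t)) = ENNReal.ofReal (Real.exp (∑ t ∈ s, f t)) := by
  rw [Real.exp_sum, ENNReal.ofReal_prod_of_nonneg fun _ _ => (Real.exp_pos _).le]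

/-- Change of model for an event that is determined by the rounds before `N`. -/
lemma law_gaussianModel_eq_setLIntegral (π : Policy K) (μ μ' : Fin K → ℝ) {v : ℝ≥0} (hv : v ≠ 0)
    (N : ℕ) {E : Set (ℕ → Round K)} (hE : MeasurableSet E)
    (hEN : ∀ ω ω', (∀ t < N, ω t = ω' t) → (ω ∈ E ↔ ω' ∈ E)) :
    law π (gaussianModel μ' v) E =
      ∫⁻ ω in E, ENNReal.ofReal (Real.exp (∑ t ∈ range N, logRatio μ μ' v (ω t)))
        ∂law π (gaussianModel μ v) := by
  classical
  rw [← lintegral_indicator_one hE, lintegral_law_change π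
    (ρ := fun y => ENNReal.ofReal (Real.exp (logRatio μ μ' v y)))
    ((measurable_logRatio μ μ' v).exp.ennreal_ofReal) (rewardLaw_gaussianModel μ μ' hv) N
    (measurable_one.indicator hE) fun ω ω' h => by simp [Set.indicator_apply, hEN ω ω' h],
    ← lintegral_indicator hE]
  refine lintegral_congr fun ω => ?_
  rw [ofReal_exp_sum]
  by_cases h : ω ∈ E <;> simp [h]

/-- The stopped likelihood ratio is a martingale. From N to N + 1 it is frozen off `running K N`. On
this event, its integrals at both times are the probability of the event under the other model. -/
lemma lintegral_exp_stoppedLogRatio (π : Policy K) (μ μ' : Fin K → ℝ) {v : ℝ≥0} (hv : v ≠ 0)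
    (N : ℕ) :
    ∫⁻ ω, ENNReal.ofReal (Real.exp (stoppedLogRatio μ μ' v N ω)) ∂law π (gaussianModel μ v) = 1 := by
  induction N with
  | zero => simp [stoppedLogRatio]
  | succ N ih =>
    have hrun := measurableSet_running (K := K) N
    rw [← ih, ← lintegral_add_compl
      (fun ω => ENNReal.ofReal (Real.exp (stoppedLogRatio μ μ' v (N + 1) ω))) hrun,
      ← lintegral_add_compl (fun ω => ENNReal.ofReal (Real.exp (stoppedLogRatio μ μ' v N ω))) hrun]
    congr 1
    · have h1 := law_gaussianModel_eq_setLIntegral π μ μ' hv N hrun fun ω ω' h => running_congr h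
      have h2 := law_gaussianModel_eq_setLIntegral π μ μ' hv (N + 1) hrun
        fun ω ω' h => running_congr fun s hs => h s (by omega)
      refine Eq.trans (setLIntegral_congr_fun hrun fun ω hω => ?_)
        (h2.symm.trans (h1.trans (setLIntegral_congr_fun hrun fun ω hω => ?_)))
      · simp only [stoppedLogRatio_eq_of_mem_running μ μ' v hω]
      · have : stoppedLogRatio μ μ' v N ω = ∑ t ∈ range N, logRatio μ μ' v (ω t) :=
          sum_congr rfl fun t ht => Set.indicator_of_mem
            (running_antitone (by simp at ht; omega : t ≤ N) hω) _
        simp only [this]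
    · refine setLIntegral_congr_fun hrun.compl fun ω hω => ?_
      simp only [stoppedLogRatio_eq_of_notMem_running μ μ' v N.le_succ hω]

/-- The event is split by the stopping round t. Each piece is determined by the rounds up to t, and
the stopped ratio does not change after t. -/
lemma law_recommendsBefore (π : Policy K) (μ μ' : Fin K → ℝ) {v : ℝ≥0} (hv : v ≠ 0) (N : ℕ)
    (i : Fin K) :
    law π (gaussianModel μ' v) (recommendsBefore N i) =
      ∫⁻ ω in recommendsBefore N i, ENNReal.ofReal (Real.exp (stoppedLogRatio μ μ' v N ω))
        ∂law π (gaussianModel μ v) := by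
  have hd : ((range N : Finset ℕ) : Set ℕ).PairwiseDisjoint (fun t => recommendsAt t i) :=
    fun s _ t _ hst => Set.disjoint_left.2 fun ω hs ht => hst (eq_of_mem_recommendsAt hs ht)
  rw [recommendsBefore, measure_biUnion_finset hd fun t _ => measurableSet_recommendsAt t i,
    lintegral_biUnion_finset hd fun t _ => measurableSet_recommendsAt t i]
  refine sum_congr rfl fun t ht => ?_
  rw [law_gaussianModel_eq_setLIntegral π μ μ' hv (t + 1) (measurableSet_recommendsAt t i)]
  · refine setLIntegral_congr_fun (measurableSet_recommendsAt t i) fun ω hω => ?_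
    rw [stoppedLogRatio_eq_of_notMem_running μ μ' v (by simpa using ht : t + 1 ≤ N)
      (not_mem_running_of_recommendsAt t.lt_succ_self hω),
      stoppedLogRatio_eq_of_mem_running μ μ' v hω.1]
  · intro ω ω' h
    simp only [recommendsAt, Set.mem_inter_iff, Set.mem_ofPred_eq, h t t.lt_succ_self]
    rw [running_congr fun s hs => h s (by omega)]

/-- The expected number of pulls of arm `a` in the rounds before `N`, up to the stopping time. -/
def expectedPulls (π : Policy K) (ν : Model K) (N : ℕ) (a : Fin K) : ℝ :=
  ∑ t ∈ range N, (law π ν).real (pullsAt t a)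

lemma indicator_running_logRatio (μ μ' : Fin K → ℝ) (v : ℝ≥0) (t : ℕ) (ω : ℕ → Round K) :
    (running K t).indicator (fun ω => logRatio μ μ' v (ω t)) ω =
      ∑ a, (pullsAt t a).indicator (fun ω => logRatio μ μ' v (.pull a, (ω t).2)) ω := by
  classical
  by_cases h : ω ∈ running K t
  · cases hd : (ω t).1 with
    | pull b =>
      have e : ω t = (.pull b, (ω t).2) := by rw [← hd]
      rw [sum_eq_single b, Set.indicator_of_mem h,
        Set.indicator_of_mem (show ω ∈ pullsAt t b from ⟨h, hd⟩), ← e]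
      · intro a _ hab
        refine Set.indicator_of_notMem (fun hm => hab ?_) _
        simpa using hm.2.symm.trans hd
      · simp
    | recommend i =>
      have e : ω t = (.recommend i, (ω t).2) := by rw [← hd]
      rw [sum_eq_zero, Set.indicator_of_mem h, e]
      · rfl
      · intro a _
        refine Set.indicator_of_notMem (fun hm => ?_) _
        simpa using hm.2.symm.trans hd
  · rw [Set.indicator_of_notMem h, sum_eq_zero]
    exact fun a _ => Set.indicator_of_notMem (fun hm => h hm.1) _

lemma integrable_logRatio_gaussianReal (μ μ' : Fin K → ℝ) (v : ℝ≥0) (a : Fin K) :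
    Integrable (fun x => logRatio μ μ' v (.pull a, x)) (gaussianReal (μ a) v) := by
  have h : Integrable (fun x : ℝ => x) (gaussianReal (μ a) v) :=
    memLp_one_iff_integrable.1 (memLp_id_gaussianReal 1)
  exact (((h.sub (integrable_const _)).const_mul _).sub (integrable_const _)).div_const _

/-- For v ≠ 0 this is minus the Kullback–Leibler divergence of two Gaussians of equal variance. -/
lemma integral_logRatio_gaussianReal (μ μ' : Fin K → ℝ) (v : ℝ≥0) (a : Fin K) :
    ∫ x, logRatio μ μ' v (.pull a, x) ∂gaussianReal (μ a) v = -((μ' a - μ a) ^ 2 / (2 * v)) := by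
  have h : Integrable (fun x : ℝ => x) (gaussianReal (μ a) v) :=
    memLp_one_iff_integrable.1 (memLp_id_gaussianReal 1)
  have h' : Integrable (fun x : ℝ => (μ' a - μ a) * (x - μ a)) (gaussianReal (μ a) v) :=
    (h.sub (integrable_const _)).const_mul _
  simp only [logRatio]
  rw [integral_div, integral_sub h' (integrable_const _), integral_const_mul,
    integral_sub h (integrable_const _), integral_id_gaussianReal]
  simp
  ring

lemma integrableOn_pullsAt_logRatio (π : Policy K) (μ μ' : Fin K → ℝ) (v : ℝ≥0) (t : ℕ)
    (a : Fin K) :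
    IntegrableOn (fun ω => logRatio μ μ' v (.pull a, (ω t).2)) (pullsAt t a)
      (law π (gaussianModel μ v)) := by
  have hm : Measurable fun ω : ℕ → Round K => (ω t).2 := by fun_prop
  have hi := integrable_logRatio_gaussianReal μ μ' v a
  refine (integrable_map_measure (f := fun ω : ℕ → Round K => (ω t).2)
    (g := fun x => logRatio μ μ' v (.pull a, x)) ?_ hm.aemeasurable).1 ?_
  · exact ((measurable_logRatio μ μ' v).comp measurable_prodMk_left).aestronglyMeasurable
  · rw [map_restrict_pullsAt]
    exact hi.smul_measure (measure_ne_top _ _)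

lemma setIntegral_pullsAt_logRatio (π : Policy K) (μ μ' : Fin K → ℝ) (v : ℝ≥0) (t : ℕ)
    (a : Fin K) :
    ∫ ω in pullsAt t a, logRatio μ μ' v (.pull a, (ω t).2) ∂law π (gaussianModel μ v) =
      -((law π (gaussianModel μ v)).real (pullsAt t a) * ((μ' a - μ a) ^ 2 / (2 * v))) := by
  have hm : Measurable fun ω : ℕ → Round K => (ω t).2 := by fun_prop
  rw [← integral_map (φ := fun ω : ℕ → Round K => (ω t).2)
    (f := fun x => logRatio μ μ' v (.pull a, x)) hm.aemeasurable
    ((measurable_logRatio μ μ' v).comp measurable_prodMk_left).aestronglyMeasurable,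
    map_restrict_pullsAt, integral_smul_measure]
  have := integral_logRatio_gaussianReal μ μ' v a
  simp only [gaussianModel, ProbabilityMeasure.coe_mk, this]
  simp [Measure.real]

lemma integrable_indicator_running_logRatio (π : Policy K) (μ μ' : Fin K → ℝ) (v : ℝ≥0) (t : ℕ) :
    Integrable ((running K t).indicator (fun ω => logRatio μ μ' v (ω t)))
      (law π (gaussianModel μ v)) := by
  have : (running K t).indicator (fun ω => logRatio μ μ' v (ω t)) = fun ω =>
      ∑ a, (pullsAt t a).indicator (fun ω => logRatio μ μ' v (.pull a, (ω t).2)) ω :=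
    funext (indicator_running_logRatio μ μ' v t)
  rw [this]
  exact integrable_finsetSum _ fun a _ =>
    (integrableOn_pullsAt_logRatio π μ μ' v t a).integrable_indicator (measurableSet_pullsAt t a)

lemma integrable_stoppedLogRatio (π : Policy K) (μ μ' : Fin K → ℝ) (v : ℝ≥0) (N : ℕ) :
    Integrable (stoppedLogRatio μ μ' v N) (law π (gaussianModel μ v)) :=
  integrable_finsetSum _ fun t _ => integrable_indicator_running_logRatio π μ μ' v t

/-- The Kullback-Leibler divergence up to the stopping time and round `N`. -/
lemma integral_stoppedLogRatio (π : Policy K) (μ μ' : Fin K → ℝ) (v : ℝ≥0) (N : ℕ) :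
    ∫ ω, stoppedLogRatio μ μ' v N ω ∂law π (gaussianModel μ v) =
      -∑ a, expectedPulls π (gaussianModel μ v) N a * ((μ' a - μ a) ^ 2 / (2 * v)) := by
  unfold stoppedLogRatio expectedPulls
  rw [integral_finsetSum _ fun t _ => integrable_indicator_running_logRatio π μ μ' v t]
  simp only [sum_mul]
  rw [sum_comm, ← sum_neg_distrib]
  refine sum_congr rfl fun t _ => ?_
  -- Wald's identity, round by round: given a pull of arm a, the reward has law `ν a`, so each pull
  -- contributes the same divergence. The horizon is finite, so no optional stopping is needed.
  simp only [indicator_running_logRatio]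
  rw [integral_finsetSum _ fun a _ => (integrableOn_pullsAt_logRatio π μ μ' v t
    a).integrable_indicator (measurableSet_pullsAt t a), ← sum_neg_distrib]
  refine sum_congr rfl fun a _ => ?_
  rw [integral_indicator (measurableSet_pullsAt t a), setIntegral_pullsAt_logRatio]

/-- A minorant that is affine in x and eˣ, so that it can be integrated knowing only 𝔼 X = -κ and 𝔼
e^X = 1; the result is e^{-κ}/2. With q = e^{-κ} and u = e^{(x+κ)/2} ≥ 1 + (x+κ)/2, one has eˣ = q
u², and both bounds come from completing a square. -/
lemma exp_mul_le_min_one_exp (κ x : ℝ) :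
    Real.exp (-κ) * (3 / 4 + (x + κ) / 2 - Real.exp x / 4) ≤ min 1 (Real.exp x) := by
  have h1 := Real.add_one_le_exp ((x + κ) / 2)
  set u := Real.exp ((x + κ) / 2) with hu
  have hu0 : 0 < u := Real.exp_pos _
  have hκ : 0 < Real.exp (-κ) := Real.exp_pos _
  have hx : Real.exp x = Real.exp (-κ) * u ^ 2 := by
    rw [hu, ← Real.exp_nat_mul, ← Real.exp_add]; congr 1; push_cast; ring
  set q := Real.exp (-κ) with hq
  have h2 : q * (3 / 4 + (x + κ) / 2 - Real.exp x / 4) ≤ q * (u - (1 + q * u ^ 2) / 4) := by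
    exact mul_le_mul_of_nonneg_left (by rw [hx]; linarith) hκ.le
  refine h2.trans (le_min ?_ ?_)
  · nlinarith [sq_nonneg (q * u - 2)]
  · rw [hx]; nlinarith [mul_nonneg hκ.le (sq_nonneg (2 * u - 1)), sq_nonneg (q * u)]

/-- The Bretagnolle-Huber inequality for the recommendation of a policy. -/
theorem exp_neg_le_law_recommendsBefore (π : Policy K) (μ μ' : Fin K → ℝ) {v : ℝ≥0} (hv : v ≠ 0)
    (N : ℕ) (i : Fin K) :
    Real.exp (-∑ a, expectedPulls π (gaussianModel μ v) N a * ((μ' a - μ a) ^ 2 / (2 * v))) / 2 ≤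
      (law π (gaussianModel μ v)).real (recommendsBefore N i)ᶜ +
        (law π (gaussianModel μ' v)).real (recommendsBefore N i) := by
  set P := law π (gaussianModel μ v)
  set E := recommendsBefore N i
  set X := stoppedLogRatio μ μ' v N
  set κ := ∑ a, expectedPulls π (gaussianModel μ v) N a * ((μ' a - μ a) ^ 2 / (2 * v))
  have hE : MeasurableSet E := measurableSet_recommendsBefore N i
  have hXm : Measurable X := measurable_stoppedLogRatio μ μ' v N
  have hX : Integrable X P := integrable_stoppedLogRatio π μ μ' v N
  have hXint : ∫ ω, X ω ∂P = -κ := integral_stoppedLogRatio π μ μ' v N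
  have hM1 : ∫⁻ ω, ENNReal.ofReal (Real.exp (X ω)) ∂P = 1 :=
    lintegral_exp_stoppedLogRatio π μ μ' hv N
  have hM : Integrable (fun ω => Real.exp (X ω)) P := by
    refine ⟨hXm.exp.aestronglyMeasurable, ?_⟩
    rw [hasFiniteIntegral_iff_ofReal (.of_forall fun ω => (Real.exp_pos _).le), hM1]
    exact ENNReal.one_lt_top
  have hMint : ∫ ω, Real.exp (X ω) ∂P = 1 := by
    rw [integral_eq_lintegral_of_nonneg_ae (.of_forall fun ω => (Real.exp_pos _).le)
      hXm.exp.aestronglyMeasurable, hM1, ENNReal.toReal_one]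
  have hP' : (law π (gaussianModel μ' v)).real E = ∫ ω in E, Real.exp (X ω) ∂P := by
    rw [integral_eq_lintegral_of_nonneg_ae (.of_forall fun ω => (Real.exp_pos _).le)
      hXm.exp.aestronglyMeasurable, Measure.real, law_recommendsBefore π μ μ' hv N i]
  have heq : (fun ω => Real.exp (-κ) * (3 / 4 + (X ω + κ) / 2 - Real.exp (X ω) / 4)) =
      fun ω => Real.exp (-κ) * (3 / 4 + κ / 2) +
        (Real.exp (-κ) / 2 * X ω - Real.exp (-κ) / 4 * Real.exp (X ω)) := by
    ext ω; ring
  have h1 : Integrable (fun ω => Real.exp (-κ) / 2 * X ω) P := hX.const_mul _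
  have h2 : Integrable (fun ω => Real.exp (-κ) / 4 * Real.exp (X ω)) P := hM.const_mul _
  have h3 : Integrable (fun ω => Real.exp (-κ) / 2 * X ω - Real.exp (-κ) / 4 * Real.exp (X ω)) P :=
    h1.sub h2
  have hlow : Integrable
      (fun ω => Real.exp (-κ) * (3 / 4 + (X ω + κ) / 2 - Real.exp (X ω) / 4)) P := by
    rw [heq]; exact (integrable_const _).add h3
  have hlow_int : ∫ ω, Real.exp (-κ) * (3 / 4 + (X ω + κ) / 2 - Real.exp (X ω) / 4) ∂P =
      Real.exp (-κ) / 2 := by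
    rw [heq, integral_add (integrable_const _) h3, integral_sub h1 h2, integral_const_mul,
      integral_const_mul, integral_const_mul, hXint, hMint]
    simp
    ring
  -- The minorant is compared with 1 on the complement of `E` and with the density e^X on `E`.
  rw [← hlow_int, ← integral_add_compl hE hlow, hP', add_comm, ← setIntegral_one_eq_measureReal]
  refine add_le_add ?_ ?_
  · exact setIntegral_mono hlow.integrableOn (integrable_const _).integrableOn
      fun ω => (exp_mul_le_min_one_exp κ (X ω)).trans (min_le_left _ _)
  · exact setIntegral_mono hlow.integrableOn hM.integrableOn
      fun ω => (exp_mul_le_min_one_exp κ (X ω)).trans (min_le_right _ _)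

/-! ### From error probabilities to the risk -/

/-- The policy stops in one of the rounds before `N` and recommends an arm other than `i`. -/
def errsBefore (N : ℕ) (i : Fin K) : Set (ℕ → Round K) :=
  ⋃ k ∈ univ.erase i, recommendsBefore N k

lemma measurableSet_errsBefore (N : ℕ) (i : Fin K) : MeasurableSet (errsBefore N i) :=
  Finset.measurableSet_biUnion _ fun k _ => measurableSet_recommendsBefore N k

lemma recommendsBefore_subset_errsBefore {N : ℕ} {i j : Fin K} (h : j ≠ i) :
    recommendsBefore N j ⊆ errsBefore N i :=
  Set.subset_biUnion_of_mem (u := fun k => recommendsBefore N k) (by simpa using h)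

lemma regret_of_mem_recommendsBefore (ν : Model K) {N : ℕ} {k : Fin K} {ω : ℕ → Round K}
    (h : ω ∈ recommendsBefore N k) : regret ν ω = ENNReal.ofReal (gap ν k) := by
  classical
  simp only [recommendsBefore, Set.mem_iUnion] at h
  obtain ⟨t, -, hrun, hk⟩ := h
  have hex : ∃ t, StopsAt ω t := ⟨t, k, hk⟩
  have hfind : Nat.find hex = t := (Nat.find_eq_iff hex).2 ⟨⟨k, hk⟩, hrun⟩
  have hk' : (ω t).1 = .recommend k := hk
  rw [regret, dif_pos hex]
  simp only [hfind, hk']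

/-- `running K (t + 1)` is the event t < τ, so the sum counts min(τ, N). -/
lemma sum_indicator_running_le_stoppingTime (N : ℕ) (ω : ℕ → Round K) :
    ∑ t ∈ range N, (running K (t + 1)).indicator 1 ω ≤ stoppingTime ω := by
  classical
  unfold stoppingTime
  split_ifs with hex
  · have h (t : ℕ) : (running K (t + 1)).indicator (1 : (ℕ → Round K) → ℝ≥0∞) ω ≤
        if t ∈ range (Nat.find hex) then 1 else 0 := by
      refine Set.indicator_apply_le' (fun hr => ?_) fun _ => zero_le
      have : t < Nat.find hex := by
        by_contra! hle
        exact hr _ (by omega) (Nat.find_spec hex)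
      simp [this]
    refine (sum_le_sum fun t _ => h t).trans ?_
    rw [sum_ite_mem, sum_const, nsmul_one]
    exact_mod_cast (card_le_card inter_subset_right).trans (card_range _).le
  · exact le_top

lemma law_running_succ (π : Policy K) (ν : Model K) (t : ℕ) :
    (law π ν).real (running K (t + 1)) = ∑ a, (law π ν).real (pullsAt t a) := by
  have h : running K (t + 1) = ⋃ a ∈ (univ : Finset (Fin K)), pullsAt t a := by
    ext ω; simp [mem_running_succ]
  rw [h, measureReal_biUnion_finset _ fun a _ => measurableSet_pullsAt t a]
  intro a _ b _ hab
  refine Set.disjoint_left.2 fun ω ha hb => hab ?_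
  simpa using ha.2.symm.trans hb.2

lemma sum_expectedPulls (π : Policy K) (ν : Model K) (N : ℕ) :
    ∑ a, expectedPulls π ν N a = ∑ t ∈ range N, (law π ν).real (running K (t + 1)) := by
  simp only [expectedPulls, law_running_succ]
  exact sum_comm

lemma expectedPulls_nonneg (π : Policy K) (ν : Model K) (N : ℕ) (a : Fin K) :
    0 ≤ expectedPulls π ν N a := sum_nonneg fun _ _ => measureReal_nonneg

/-- Markov's inequality for min(τ, N). -/
lemma mul_law_running_le (π : Policy K) (ν : Model K) (N : ℕ) :
    N * (law π ν).real (running K N) ≤ ∑ a, expectedPulls π ν N a := by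
  rw [sum_expectedPulls]
  calc N * (law π ν).real (running K N) = ∑ t ∈ range N, (law π ν).real (running K N) := by simp
    _ ≤ _ := sum_le_sum fun t ht => measureReal_mono (running_antitone (by simpa using ht))

lemma ofReal_le_risk (π : Policy K) (ν : Model K) {c Δ : ℝ} (hc : 0 ≤ c) (hΔ : 0 ≤ Δ) (N : ℕ)
    {i : Fin K} (hgap : ∀ k ≠ i, Δ ≤ gap ν k) :
    ENNReal.ofReal (Δ * (law π ν).real (errsBefore N i) + c * ∑ a, expectedPulls π ν N a) ≤
      risk c π ν := by
  have hE := measurableSet_errsBefore N i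
  have hmsum : Measurable fun ω : ℕ → Round K =>
      ∑ t ∈ range N, (running K (t + 1)).indicator (1 : (ℕ → Round K) → ℝ≥0∞) ω :=
    Finset.measurable_fun_sum _ fun t _ => measurable_one.indicator (measurableSet_running _)
  have h : ∫⁻ ω, (ENNReal.ofReal Δ * (errsBefore N i).indicator 1 ω + ENNReal.ofReal c *
      ∑ t ∈ range N, (running K (t + 1)).indicator 1 ω) ∂law π ν ≤ risk c π ν := by
    refine lintegral_mono fun ω => add_le_add ?_ ?_
    · by_cases hω : ω ∈ errsBefore N i
      · rw [Set.indicator_of_mem hω]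
        simp only [errsBefore, Set.mem_iUnion] at hω
        obtain ⟨k, hk, hω⟩ := hω
        rw [regret_of_mem_recommendsBefore ν hω]
        simpa using ENNReal.ofReal_le_ofReal (hgap k (by simpa using hk))
      · simp [hω]
    · gcongr
      exact sum_indicator_running_le_stoppingTime N ω
  refine le_of_eq_of_le ?_ h
  rw [lintegral_add_left ((measurable_one.indicator hE).const_mul _),
    lintegral_const_mul _ (measurable_one.indicator hE), lintegral_const_mul _ hmsum,
    lintegral_finsetSum _ fun t _ => measurable_one.indicator (measurableSet_running _),
    lintegral_indicator_one hE, sum_expectedPulls]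
  simp only [lintegral_indicator_one (measurableSet_running _)]
  rw [ENNReal.ofReal_add (by positivity) (mul_nonneg hc (sum_nonneg fun _ _ => measureReal_nonneg)),
    ENNReal.ofReal_mul hΔ, ENNReal.ofReal_mul hc,
    ENNReal.ofReal_sum_of_nonneg fun _ _ => measureReal_nonneg]
  simp [Measure.real]

/-- Two Gaussian models with different best arms cannot both have a small risk. -/
lemma two_point_bound (π : Policy K) (μ μ' : Fin K → ℝ) {v : ℝ≥0} (hv : v ≠ 0) {c Δ R : ℝ}
    (hc : 0 < c) (hΔ : 0 ≤ Δ) (hR : 0 ≤ R) {i j : Fin K} (hij : i ≠ j)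
    (hgap : ∀ k ≠ i, Δ ≤ gap (gaussianModel μ v) k)
    (hgap' : ∀ k ≠ j, Δ ≤ gap (gaussianModel μ' v) k)
    (hrisk : risk c π (gaussianModel μ v) ≤ ENNReal.ofReal R)
    (hrisk' : risk c π (gaussianModel μ' v) ≤ ENNReal.ofReal R) {N : ℕ} (hN : 0 < N) :
    Δ / 2 * Real.exp
        (-∑ a, expectedPulls π (gaussianModel μ v) N a * ((μ' a - μ a) ^ 2 / (2 * v))) +
      c * ∑ a, expectedPulls π (gaussianModel μ v) N a ≤ 2 * R + Δ * R / c / N := by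
  have h1 := (ENNReal.ofReal_le_ofReal_iff hR).1
    ((ofReal_le_risk π _ hc.le hΔ N hgap).trans hrisk)
  have h2 := (ENNReal.ofReal_le_ofReal_iff hR).1
    ((ofReal_le_risk π _ hc.le hΔ N hgap').trans hrisk')
  have hBH := exp_neg_le_law_recommendsBefore π μ μ' hv N i
  have hrun := mul_law_running_le π (gaussianModel μ v) N
  have hs0 : 0 ≤ ∑ a, expectedPulls π (gaussianModel μ' v) N a :=
    sum_nonneg fun _ _ => expectedPulls_nonneg _ _ _ _
  set s := ∑ a, expectedPulls π (gaussianModel μ v) N a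
  set P := law π (gaussianModel μ v)
  set P' := law π (gaussianModel μ' v)
  -- Without a recommendation of i before round N, the policy has either erred or not stopped yet;
  -- the second case costs the term in 1/N.
  have hsub : P.real (recommendsBefore N i)ᶜ ≤ P.real (errsBefore N i) + P.real (running K N) := by
    refine (measureReal_mono fun ω hω => ?_).trans (measureReal_union_le _ _)
    rcases mem_running_or_mem_recommendsBefore N ω with h | ⟨k, h⟩
    · exact .inr h
    · refine .inl (recommendsBefore_subset_errsBefore ?_ h)
      rintro rfl
      exact hω h
  have hsub' : P'.real (recommendsBefore N i) ≤ P'.real (errsBefore N j) :=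
    measureReal_mono (recommendsBefore_subset_errsBefore hij)
  have hN' : (0 : ℝ) < N := by exact_mod_cast hN
  have hrun' : P.real (running K N) ≤ R / c / N := by
    rw [le_div_iff₀ hN', le_div_iff₀ hc]
    have h3 := mul_nonneg hΔ (measureReal_nonneg (μ := P) (s := errsBefore N i))
    calc P.real (running K N) * N * c = c * (N * P.real (running K N)) := by ring
      _ ≤ c * s := mul_le_mul_of_nonneg_left hrun hc.le
      _ ≤ R := by linarith
  have h3 := mul_le_mul_of_nonneg_left (hBH.trans (add_le_add hsub hsub')) hΔ
  have h4 := mul_le_mul_of_nonneg_left hrun' hΔ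
  have h5 := mul_nonneg hc.le hs0
  have h6 : Δ * (R / c / N) = Δ * R / c / N := by ring
  linarith

/-- The left side is the minimum of the convex right side over s ≥ 0. The stationary point is s =
(Hσ²/2) log(Δ/(σ²cH)) if this is nonnegative; otherwise the minimum is at s = 0. These are the two
cases of `hardness`. -/
lemma two_mul_hardness_le {σ c H Δ s : ℝ} (hσ : 0 < σ) (hc : 0 < c) (hH : 0 < H) (hΔ : 0 ≤ Δ)
    (hs : 0 ≤ s) :
    2 * hardness σ c H Δ ≤ c * s + Δ / 2 * Real.exp (-(2 * s / (H * σ ^ 2))) := by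
  unfold hardness
  have hx : 0 < σ ^ 2 * c * H := by positivity
  split_ifs with h
  · have hΔ' : 0 < Δ := hx.trans_le h
    have hlog : Real.log (Real.exp 1 * Δ / (σ ^ 2 * c * H)) =
        1 + Real.log (Δ / (σ ^ 2 * c * H)) := by
      rw [mul_div_assoc, Real.log_mul (Real.exp_pos _).ne' (by positivity), Real.log_exp]
    -- The exponent is centred at the minimizer, where the bound 1 + y ≤ e^y is then sharp.
    have hexp : Real.exp (-(2 * s / (H * σ ^ 2))) = σ ^ 2 * c * H / Δ *
        Real.exp (Real.log (Δ / (σ ^ 2 * c * H)) - 2 * s / (H * σ ^ 2)) := by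
      rw [sub_eq_add_neg, Real.exp_add, Real.exp_log (by positivity)]
      field_simp
    have h1 := Real.add_one_le_exp (Real.log (Δ / (σ ^ 2 * c * H)) - 2 * s / (H * σ ^ 2))
    rw [hlog, hexp]
    set L := Real.log (Δ / (σ ^ 2 * c * H))
    have h2 : σ ^ 2 * c * H / 2 * (L - 2 * s / (H * σ ^ 2) + 1) ≤ Δ / 2 * (σ ^ 2 * c * H / Δ *
        Real.exp (L - 2 * s / (H * σ ^ 2))) := by
      have : Δ / 2 * (σ ^ 2 * c * H / Δ * Real.exp (L - 2 * s / (H * σ ^ 2))) =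
        σ ^ 2 * c * H / 2 * Real.exp (L - 2 * s / (H * σ ^ 2)) := by field_simp
      rw [this]
      exact mul_le_mul_of_nonneg_left h1 (by positivity)
    have h3 : σ ^ 2 * c * H / 2 * (L - 2 * s / (H * σ ^ 2) + 1) =
        2 * (c * σ ^ 2 * H / 4 * (1 + L)) - c * s := by
      field_simp
      ring
    linarith
  · have h1 := Real.add_one_le_exp (-(2 * s / (H * σ ^ 2)))
    have h2 := mul_le_mul_of_nonneg_left h1 (by positivity : 0 ≤ Δ / 2)
    have h3 : Δ * s / (H * σ ^ 2) ≤ c * s := by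
      rw [div_le_iff₀ (by positivity)]
      nlinarith
    have h4 : Δ / 2 * (-(2 * s / (H * σ ^ 2)) + 1) = Δ / 2 - Δ * s / (H * σ ^ 2) := by ring
    linarith

/-- The lower bound on the worst-case risk over a set `S` of models, if `S` contains a Gaussian
model and, for every allocation `n` of the pulls, one with another best arm which is hard to
distinguish from it with this allocation. -/
theorem ofReal_hardness_le_iSup_risk {σ c H Δ : ℝ} (hσ : 0 < σ) (hc : 0 < c) (hH : 0 < H)
    (hΔ : 0 ≤ Δ) {S : Set (Model K)} {μ : Fin K → ℝ} {i : Fin K}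
    (hμ : gaussianModel μ (σ ^ 2).toNNReal ∈ S)
    (hgap : ∀ k ≠ i, Δ ≤ gap (gaussianModel μ (σ ^ 2).toNNReal) k)
    (halt : ∀ n : Fin K → ℝ, (∀ a, 0 ≤ n a) → ∃ μ' : Fin K → ℝ, ∃ j, i ≠ j ∧
      gaussianModel μ' (σ ^ 2).toNNReal ∈ S ∧
      (∀ k ≠ j, Δ ≤ gap (gaussianModel μ' (σ ^ 2).toNNReal) k) ∧
      ∑ a, n a * (μ' a - μ a) ^ 2 ≤ 4 * (∑ a, n a) / H)
    (π : Policy K) :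
    ENNReal.ofReal (hardness σ c H Δ) ≤ ⨆ ν ∈ S, risk c π ν := by
  have hσ2 : 0 < σ ^ 2 := by positivity
  have hv : (σ ^ 2).toNNReal ≠ 0 := by simpa using hσ.ne'
  have hvc : ((σ ^ 2).toNNReal : ℝ) = σ ^ 2 := Real.coe_toNNReal _ hσ2.le
  generalize (σ ^ 2).toNNReal = v at *
  by_cases htop : ⨆ ν ∈ S, risk c π ν = ∞
  · simp [htop]
  set R := (⨆ ν ∈ S, risk c π ν).toReal with hRdef
  have hR : 0 ≤ R := ENNReal.toReal_nonneg
  have hRS : ∀ ν ∈ S, risk c π ν ≤ ENNReal.ofReal R := fun ν hν => by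
    rw [hRdef, ENNReal.ofReal_toReal htop]
    exact le_iSup₂ (f := fun ν (_ : ν ∈ S) => risk c π ν) ν hν
  have hlim : Filter.Tendsto (fun N : ℕ => 2 * R + Δ * R / c / (N : ℝ)) Filter.atTop
      (nhds (2 * R + 0)) :=
    tendsto_const_nhds.add (tendsto_const_div_atTop_nhds_zero_nat _)
  have key : 2 * hardness σ c H Δ ≤ 2 * R + 0 := by
    refine ge_of_tendsto hlim (Filter.eventually_atTop.2 ⟨1, fun N hN => ?_⟩)
    -- The alternative may change with N, since R bounds the risk on all of `S`.
    set n := expectedPulls π (gaussianModel μ v) N with hn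
    have hn0 a : 0 ≤ n a := expectedPulls_nonneg _ _ _ _
    obtain ⟨μ', j, hij, hμ', hgap', hsum⟩ := halt n hn0
    have h1 := two_point_bound π μ μ' hv hc hΔ hR hij hgap hgap' (hRS _ hμ) (hRS _ hμ') hN
    rw [← hn, hvc] at h1
    have h2 := two_mul_hardness_le hσ hc hH hΔ (sum_nonneg fun a (_ : a ∈ univ) => hn0 a)
    have h3 : ∑ a, n a * ((μ' a - μ a) ^ 2 / (2 * σ ^ 2)) ≤ 2 * (∑ a, n a) / (H * σ ^ 2) := by
      calc ∑ a, n a * ((μ' a - μ a) ^ 2 / (2 * σ ^ 2))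
          = (∑ a, n a * (μ' a - μ a) ^ 2) / (2 * σ ^ 2) := by
            rw [sum_div]; exact sum_congr rfl fun a _ => by ring
        _ ≤ 4 * (∑ a, n a) / H / (2 * σ ^ 2) := by gcongr
        _ = _ := by field_simp; ring
    have h4 : Δ / 2 * Real.exp (-(2 * (∑ a, n a) / (H * σ ^ 2))) ≤
        Δ / 2 * Real.exp (-∑ a, n a * ((μ' a - μ a) ^ 2 / (2 * σ ^ 2))) := by gcongr
    linarith
  rw [← ENNReal.ofReal_toReal htop]
  exact ENNReal.ofReal_le_ofReal (by linarith)

/-- The same if the alternative models arise by increasing the mean of one arm `k` from `μ k`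
to `top`. -/
theorem ofReal_hardness_le_iSup_risk_of_update {σ c H Δ : ℝ} (hσ : 0 < σ) (hc : 0 < c)
    (hH : 0 < H) (hΔ : 0 ≤ Δ) {S : Set (Model K)} {μ : Fin K → ℝ} {i : Fin K} {top : ℝ}
    (hμ : gaussianModel μ (σ ^ 2).toNNReal ∈ S)
    (hgap : ∀ k ≠ i, Δ ≤ gap (gaussianModel μ (σ ^ 2).toNNReal) k)
    (halt : ∀ j ≠ i, gaussianModel (Function.update μ j top) (σ ^ 2).toNNReal ∈ S)
    (hgap' : ∀ j ≠ i, ∀ k ≠ j,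
      Δ ≤ gap (gaussianModel (Function.update μ j top) (σ ^ 2).toNNReal) k)
    (htop : ∀ j ≠ i, μ j < top)
    (hsum : H / 4 ≤ ∑ j ∈ univ.erase i, ((top - μ j) ^ 2)⁻¹)
    (π : Policy K) :
    ENNReal.ofReal (hardness σ c H Δ) ≤ ⨆ ν ∈ S, risk c π ν := by
  refine ofReal_hardness_le_iSup_risk hσ hc hH hΔ hμ hgap (fun n hn => ?_) π
  have hs : 0 ≤ ∑ a, n a := sum_nonneg fun a _ => hn a
  have hne : (univ.erase i).Nonempty := by
    rw [nonempty_iff_ne_empty]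
    intro h
    rw [h, sum_empty] at hsum
    linarith
  -- Pigeonhole: if every arm j ≠ i had n_j > (4 ∑ n / H)(top - μ_j)⁻², summing would exceed ∑ n.
  have hle : ∑ j ∈ univ.erase i, n j ≤
      ∑ j ∈ univ.erase i, 4 * (∑ a, n a) / H * ((top - μ j) ^ 2)⁻¹ := by
    rw [← mul_sum]
    calc ∑ j ∈ univ.erase i, n j ≤ ∑ a, n a :=
          sum_le_sum_of_subset_of_nonneg (erase_subset _ _) fun a _ _ => hn a
      _ = 4 * (∑ a, n a) / H * (H / 4) := by field_simp
      _ ≤ _ := by gcongr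
  obtain ⟨j, hj, hnj⟩ := exists_le_of_sum_le hne hle
  have hji : j ≠ i := by simpa using hj
  refine ⟨Function.update μ j top, j, hji.symm, halt j hji, hgap' j hji, ?_⟩
  rw [sum_eq_single j]
  · have h0 : 0 < (top - μ j) ^ 2 := by have := htop j hji; exact pow_pos (by linarith) 2
    rw [Function.update_self]
    calc n j * (top - μ j) ^ 2 ≤ 4 * (∑ a, n a) / H * ((top - μ j) ^ 2)⁻¹ * (top - μ j) ^ 2 := by
          gcongr
      _ = _ := by rw [mul_assoc, inv_mul_cancel₀ h0.ne', mul_one]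
  · intro a _ haj
    simp [Function.update_of_ne haj]
  · simp

/-! ### Gaps and complexity of a model with a unique best arm -/

lemma gap_eq_of_isBest {ν : Model K} {i : Fin K} (h : IsBest ν i) (k : Fin K) :
    gap ν k = mean (ν i) - mean (ν k) := by
  have : Nonempty (Fin K) := ⟨i⟩
  rw [gap, le_antisymm (ciSup_le h) (le_ciSup (f := fun a => mean (ν a))
    (Set.finite_range _).bddAbove i)]

lemma eq_of_isBest {ν : Model K} {i a : Fin K} (h : ∀ k ≠ i, mean (ν k) < mean (ν i))
    (ha : IsBest ν a) : a = i := by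
  by_contra hai
  exact (h a hai).not_ge (ha i)

lemma isBest_of_lt {ν : Model K} {i : Fin K} (h : ∀ k ≠ i, mean (ν k) < mean (ν i)) :
    IsBest ν i := fun k => by
  by_cases hk : k = i
  · rw [hk]
  · exact (h k hk).le

lemma complexity_eq {ν : Model K} {i : Fin K} (h : ∀ k ≠ i, mean (ν k) < mean (ν i)) :
    complexity ν = ENNReal.ofReal (∑ k ∈ univ.erase i, ((mean (ν i) - mean (ν k)) ^ 2)⁻¹) := by
  have hi := isBest_of_lt h
  have hsum : ∑ k ∈ univ.erase i, (ENNReal.ofReal (gap ν k) ^ 2)⁻¹ =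
      ENNReal.ofReal (∑ k ∈ univ.erase i, ((mean (ν i) - mean (ν k)) ^ 2)⁻¹) := by
    rw [ENNReal.ofReal_sum_of_nonneg fun k _ => by positivity]
    refine sum_congr rfl fun k hk => ?_
    have hpos : 0 < mean (ν i) - mean (ν k) := sub_pos.2 (h k (by simpa using hk))
    rw [gap_eq_of_isBest hi, ← ENNReal.ofReal_pow hpos.le,
      ENNReal.ofReal_inv_of_pos (by positivity)]
  rw [← hsum]
  refine le_antisymm (iInf₂_le i hi) (le_iInf₂ fun a ha => ?_)
  rw [eq_of_isBest h ha]

lemma smallestGap_eq {ν : Model K} {i j : Fin K} {Δ : ℝ} (hΔ : 0 < Δ) (hji : j ≠ i)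
    (hj : mean (ν i) - mean (ν j) = Δ) (h : ∀ k ≠ i, Δ ≤ mean (ν i) - mean (ν k)) :
    smallestGap ν = ENNReal.ofReal Δ := by
  have hlt k (hk : k ≠ i) : mean (ν k) < mean (ν i) := by linarith [h k hk]
  have hi := isBest_of_lt hlt
  refine le_antisymm ?_ (le_iInf₂ fun a ha => le_iInf₂ fun k hk => ?_)
  · refine (iInf₂_le i hi).trans ((iInf₂_le j (by simpa using hji)).trans ?_)
    rw [gap_eq_of_isBest hi, hj]
  · obtain rfl := eq_of_isBest hlt ha
    rw [gap_eq_of_isBest hi]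
    exact ENNReal.ofReal_le_ofReal (h k (by simpa using hk))

/-- Finite complexity excludes ties at the top, so the best arm is unique and the infima over best
arms have a single term. In particular, the smallest gap is positive. -/
lemma exists_best_of_complexity (hK : 2 ≤ K) {ν : Model K} {H Δ : ℝ} (hH : 0 < H) (hΔ : 0 ≤ Δ)
    (hc : complexity ν = ENNReal.ofReal H) (hg : smallestGap ν = ENNReal.ofReal Δ) :
    ∃ i j, j ≠ i ∧ 0 < Δ ∧ mean (ν i) - mean (ν j) = Δ ∧
      (∀ k ≠ i, Δ ≤ mean (ν i) - mean (ν k)) ∧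
      ∑ k ∈ univ.erase i, ((mean (ν i) - mean (ν k)) ^ 2)⁻¹ = H := by
  have hlt : complexity ν < ∞ := by rw [hc]; exact ENNReal.ofReal_lt_top
  simp only [complexity, iInf_lt_iff] at hlt
  obtain ⟨i, hi, hsum⟩ := hlt
  have hbest k (hk : k ≠ i) : mean (ν k) < mean (ν i) := by
    have h1 := (ENNReal.sum_lt_top.1 hsum) k (by simpa using hk)
    rw [gap_eq_of_isBest hi] at h1
    by_contra hle
    have : ENNReal.ofReal (mean (ν i) - mean (ν k)) = 0 := ENNReal.ofReal_of_nonpos (by linarith)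
    simp [this] at h1
  have hne : (univ.erase i).Nonempty := by
    rw [← card_pos, card_erase_of_mem (mem_univ _), card_univ, Fintype.card_fin]
    omega
  obtain ⟨j, hj, hmin⟩ := exists_min_image (univ.erase i) (fun k => mean (ν i) - mean (ν k)) hne
  have hji : j ≠ i := by simpa using hj
  have hpos : 0 < mean (ν i) - mean (ν j) := sub_pos.2 (hbest j hji)
  have hmin' k (hk : k ≠ i) : mean (ν i) - mean (ν j) ≤ mean (ν i) - mean (ν k) :=
    hmin k (by simpa using hk)
  have hΔeq : mean (ν i) - mean (ν j) = Δ := by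
    rw [smallestGap_eq hpos hji rfl hmin'] at hg
    exact (ENNReal.ofReal_eq_ofReal_iff hpos.le hΔ).1 hg
  rw [complexity_eq hbest] at hc
  rw [hΔeq] at hpos hmin'
  refine ⟨i, j, hji, hpos, hΔeq, hmin', ?_⟩
  exact (ENNReal.ofReal_eq_ofReal_iff (sum_nonneg fun _ _ => by positivity) hH.le).1 hc

/-! ### Gaussian models in the classes `models` and `modelsOfComplexity` -/

lemma mean_gaussianModel (μ : Fin K → ℝ) (v : ℝ≥0) (a : Fin K) :
    mean (gaussianModel μ v a) = μ a := integral_id_gaussianReal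

lemma subGaussian_gaussianModel (μ : Fin K → ℝ) {σ : ℝ} (hσ : 0 < σ) (a : Fin K) :
    SubGaussian σ (gaussianModel μ (σ ^ 2).toNNReal a) := by
  refine ⟨memLp_one_iff_integrable.1 (memLp_id_gaussianReal 1), fun t ht => ?_⟩
  rw [mean_gaussianModel]
  change gaussianReal (μ a) (σ ^ 2).toNNReal {x | t < x - μ a} ≤ _
  have hσ2 : 0 < σ ^ 2 := by positivity
  have hvc : ((σ ^ 2).toNNReal : ℝ) = σ ^ 2 := Real.coe_toNNReal _ hσ2.le
  -- Chernoff's bound with the optimal parameter t/σ².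
  have h := measure_ge_le_exp_mul_mgf (μ := gaussianReal (μ a) (σ ^ 2).toNNReal) (X := id)
    (t := t / σ ^ 2) (μ a + t) (by positivity) (integrable_exp_mul_gaussianReal _)
  rw [mgf_id_gaussianReal, ← Real.exp_add, hvc] at h
  have he : -(t / σ ^ 2) * (μ a + t) + (μ a * (t / σ ^ 2) + σ ^ 2 * (t / σ ^ 2) ^ 2 / 2) =
      -(t ^ 2 / (2 * σ ^ 2)) := by
    field_simp
    ring
  rw [he] at h
  rw [← ENNReal.ofReal_toReal (measure_ne_top (gaussianReal (μ a) (σ ^ 2).toNNReal) _)]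
  refine ENNReal.ofReal_le_ofReal (le_trans (measureReal_mono fun x hx => ?_) h)
  have hx' : t < x - μ a := hx
  change μ a + t ≤ x
  linarith

lemma gaussianModel_mem_models {μ : Fin K → ℝ} {σ B : ℝ} (hσ : 0 < σ)
    (h : ∀ a, μ a ∈ Set.Icc 0 B) : gaussianModel μ (σ ^ 2).toNNReal ∈ models K σ B := fun a =>
  ⟨subGaussian_gaussianModel μ hσ a, by rw [mean_gaussianModel]; exact h a⟩

lemma gaussianModel_mem_modelsOfComplexity {μ : Fin K → ℝ} {σ B H : ℝ} (hσ : 0 < σ)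
    (h : ∀ a, μ a ∈ Set.Icc 0 B) {i : Fin K} (hi : ∀ k ≠ i, μ k < μ i)
    (hH : ∑ k ∈ univ.erase i, ((μ i - μ k) ^ 2)⁻¹ ≤ H) :
    gaussianModel μ (σ ^ 2).toNNReal ∈ modelsOfComplexity K σ B H := by
  refine ⟨gaussianModel_mem_models hσ h, ?_⟩
  rw [complexity_eq (i := i) (by simpa only [mean_gaussianModel] using hi)]
  simp only [mean_gaussianModel]
  exact ENNReal.ofReal_le_ofReal hH

lemma gap_gaussianModel {μ : Fin K → ℝ} {v : ℝ≥0} {i : Fin K} (hi : ∀ k ≠ i, μ k < μ i)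
    (k : Fin K) : gap (gaussianModel μ v) k = μ i - μ k := by
  rw [gap_eq_of_isBest (i := i) (isBest_of_lt (by simpa only [mean_gaussianModel] using hi))]
  simp only [mean_gaussianModel]

/-! ### The three lower bounds -/

lemma card_erase_fin (hK : 2 ≤ K) (i : Fin K) : ((univ.erase i).card : ℝ) = K - 1 := by
  rw [card_erase_of_mem (mem_univ _), card_univ, Fintype.card_fin, Nat.cast_sub (by omega),
    Nat.cast_one]

/-- An arm with nonnegative mean rises by at most 2D, so the sum is at least (K-1)/(4D²) = H/4. This
is the source of the factor 4 and of the condition 2D ≤ B. -/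
lemma div_four_le_sum_inv_sq (hK : 2 ≤ K) {H D : ℝ} (hD : 0 < D) (hHD : H * D ^ 2 = K - 1)
    {μ : Fin K → ℝ} {i : Fin K} (h0 : ∀ k, 0 ≤ μ k) (h1 : ∀ k ≠ i, μ k < 2 * D) :
    H / 4 ≤ ∑ k ∈ univ.erase i, ((2 * D - μ k) ^ 2)⁻¹ := by
  have h : (univ.erase i).card • ((2 * D) ^ 2)⁻¹ ≤
      ∑ k ∈ univ.erase i, ((2 * D - μ k) ^ 2)⁻¹ := by
    refine card_nsmul_le_sum _ _ _ fun k hk => ?_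
    have hk' := h1 k (by simpa using hk)
    have := h0 k
    have hpos : 0 < 2 * D - μ k := by linarith
    gcongr
    linarith
  rw [nsmul_eq_mul, card_erase_fin hK, ← hHD] at h
  refine le_of_eq_of_le ?_ h
  field_simp
  norm_num

/-- In the base model and in all alternatives the best arm leads by at least D, so the complexity is
at most (K-1)/D² = H. -/
theorem ofReal_hardness_le_iSup_modelsOfComplexity (hK : 2 ≤ K) {σ c B H Δ D : ℝ} (hσ : 0 < σ)
    (hc : 0 < c) (hH : 0 < H) (hΔ : 0 ≤ Δ) (hD : 0 < D) (hHD : H * D ^ 2 = K - 1) (hΔD : Δ ≤ D)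
    (hB : 2 * D ≤ B) (π : Policy K) :
    ENNReal.ofReal (hardness σ c H Δ) ≤ ⨆ ν ∈ modelsOfComplexity K σ B H, risk c π ν := by
  classical
  have hsum {i : Fin K} {f : Fin K → ℝ} (hf : ∀ k ≠ i, D ≤ f k) :
      ∑ k ∈ univ.erase i, (f k ^ 2)⁻¹ ≤ H := by
    calc ∑ k ∈ univ.erase i, (f k ^ 2)⁻¹ ≤ (univ.erase i).card • (D ^ 2)⁻¹ := by
          refine sum_le_card_nsmul _ _ _ fun k hk => ?_
          have := hf k (by simpa using hk)
          gcongr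
      _ = H := by
          rw [nsmul_eq_mul, card_erase_fin hK, ← hHD]
          field_simp
  let i : Fin K := ⟨0, by omega⟩
  let μ : Fin K → ℝ := fun k => if k = i then D else 0
  have hμi : μ i = D := if_pos rfl
  have hμk k (hk : k ≠ i) : μ k = 0 := if_neg hk
  have hμ k : 0 ≤ μ k ∧ μ k ≤ D := by
    by_cases hk : k = i
    · rw [hk, hμi]; exact ⟨hD.le, le_rfl⟩
    · rw [hμk k hk]; exact ⟨le_rfl, hD.le⟩
  have hbest k (hk : k ≠ i) : μ k < μ i := by rw [hμi, hμk k hk]; exact hD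
  have hbest' (j k : Fin K) (hk : k ≠ j) :
      Function.update μ j (2 * D) k < Function.update μ j (2 * D) j := by
    rw [Function.update_self, Function.update_of_ne hk]
    linarith [(hμ k).2]
  refine ofReal_hardness_le_iSup_risk_of_update (i := i) (top := 2 * D) (μ := μ) hσ hc hH hΔ
    (gaussianModel_mem_modelsOfComplexity hσ (fun a => ⟨(hμ a).1, by linarith [(hμ a).2]⟩) hbest
      (hsum fun k hk => by rw [hμi, hμk k hk]; simp))
    (fun k hk => by rw [gap_gaussianModel hbest, hμi, hμk k hk]; linarith)
    (fun j hj => gaussianModel_mem_modelsOfComplexity hσ (fun a => ?_) (hbest' j)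
      (hsum fun k hk => ?_))
    (fun j hj k hk => ?_)
    (fun j hj => by linarith [(hμ j).2])
    (div_four_le_sum_inv_sq hK hD hHD (fun k => (hμ k).1) fun k _ => by linarith [(hμ k).2]) π
  · by_cases ha : a = j
    · rw [ha, Function.update_self]; exact ⟨by positivity, hB⟩
    · rw [Function.update_of_ne ha]; exact ⟨(hμ a).1, by linarith [(hμ a).2]⟩
  · rw [Function.update_self, Function.update_of_ne hk]
    linarith [(hμ k).2]
  · rw [gap_gaussianModel (hbest' j), Function.update_self, Function.update_of_ne hk]
    linarith [(hμ k).2]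

/-- Small complexity: the best and the second best arm of a model are exchanged. -/
theorem ofReal_hardness_le_iSup_smallestGap_of_le {σ c B H Δ : ℝ} (hσ : 0 < σ)
    (hc : 0 < c) (hH : 0 < H) (hΔ : 0 < Δ) {μ : Fin K → ℝ} (hμ : ∀ k, μ k ∈ Set.Icc 0 B)
    {i j : Fin K} (hji : j ≠ i) (hj : μ i - μ j = Δ) (hgap : ∀ k ≠ i, Δ ≤ μ i - μ k)
    (hsum : ∑ k ∈ univ.erase i, ((μ i - μ k) ^ 2)⁻¹ = H) (hHΔ : H * Δ ^ 2 ≤ 4) (π : Policy K) :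
    ENNReal.ofReal (hardness σ c H Δ) ≤
      ⨆ ν ∈ {ν ∈ modelsOfComplexity K σ B H | smallestGap ν = ENNReal.ofReal Δ}, risk c π ν := by
  classical
  have hbest k (hk : k ≠ i) : μ k < μ i := by linarith [hgap k hk]
  let μ' : Fin K → ℝ := fun k => μ (Equiv.swap i j k)
  have hμ'j : μ' j = μ i := by simp [μ']
  have hswap {k : Fin K} (hk : k ≠ j) : Equiv.swap i j k ≠ i := fun h => hk (by
    rw [Equiv.swap_apply_eq_iff, Equiv.swap_apply_left] at h; exact h)
  have hgap' k (hk : k ≠ j) : Δ ≤ μ' j - μ' k := by rw [hμ'j]; exact hgap _ (hswap hk)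
  have hbest' k (hk : k ≠ j) : μ' k < μ' j := by linarith [hgap' k hk]
  have hsum' : ∑ k ∈ univ.erase j, ((μ' j - μ' k) ^ 2)⁻¹ = H := by
    rw [← hsum, hμ'j]
    refine sum_equiv (Equiv.swap i j) (fun k => ?_) fun k _ => rfl
    simp only [mem_erase, mem_univ, and_true, ne_eq]
    rw [Equiv.swap_apply_eq_iff, Equiv.swap_apply_left]
  refine ofReal_hardness_le_iSup_risk
    (S := {ν ∈ modelsOfComplexity K σ B H | smallestGap ν = ENNReal.ofReal Δ})
    (i := i) (μ := μ) hσ hc hH hΔ.le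
    ⟨gaussianModel_mem_modelsOfComplexity hσ hμ hbest hsum.le, ?_⟩
    (fun k hk => by rw [gap_gaussianModel hbest]; exact hgap k hk)
    (fun n hn => ⟨μ', j, hji.symm,
      ⟨gaussianModel_mem_modelsOfComplexity hσ (fun k => hμ _) hbest' hsum'.le, ?_⟩,
      fun k hk => by rw [gap_gaussianModel hbest']; exact hgap' k hk, ?_⟩) π
  · exact smallestGap_eq hΔ hji (by simpa only [mean_gaussianModel] using hj)
      (by simpa only [mean_gaussianModel] using hgap)
  · refine smallestGap_eq (i := j) hΔ hji.symm ?_ (by simpa only [mean_gaussianModel] using hgap')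
    simpa only [mean_gaussianModel, hμ'j, μ', Equiv.swap_apply_left] using hj
  -- The exchange moves two means by Δ and no others. As HΔ² ≤ 4, every allocation meets the
  -- required bound.
  · have hd a : (μ' a - μ a) ^ 2 ≤ Δ ^ 2 := by
      by_cases hai : a = i
      · rw [hai, show μ' i = μ j by simp [μ'], ← hj]; exact le_of_eq (by ring)
      · by_cases haj : a = j
        · rw [haj, hμ'j, hj]
        · simp only [μ', Equiv.swap_apply_of_ne_of_ne hai haj, sub_self]
          exact pow_le_pow_left₀ le_rfl hΔ.le 2
    have hs : 0 ≤ ∑ a, n a := sum_nonneg fun a _ => hn a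
    calc ∑ a, n a * (μ' a - μ a) ^ 2 ≤ ∑ a, n a * Δ ^ 2 :=
          sum_le_sum fun a _ => mul_le_mul_of_nonneg_left (hd a) (hn a)
      _ = (∑ a, n a) * Δ ^ 2 := (sum_mul ..).symm
      _ ≤ 4 * (∑ a, n a) / H := by
          rw [le_div_iff₀ hH]
          nlinarith

/-- Large complexity: two arms at the top, and all other arms far below. -/
theorem ofReal_hardness_le_iSup_smallestGap_of_ge (hK : 2 ≤ K) {σ c B H Δ D : ℝ} (hσ : 0 < σ)
    (hc : 0 < c) (hH : 0 < H) (hΔ : 0 < Δ) (hD : 0 < D) (hHD : H * D ^ 2 = K - 1) (hΔD : Δ ≤ D)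
    (hB : 2 * D ≤ B) (hHΔ : 4 ≤ H * Δ ^ 2) {i j : Fin K} (hji : j ≠ i) (π : Policy K) :
    ENNReal.ofReal (hardness σ c H Δ) ≤
      ⨆ ν ∈ {ν ∈ modelsOfComplexity K σ B H | smallestGap ν = ENNReal.ofReal Δ}, risk c π ν := by
  classical
  let μ : Fin K → ℝ := fun k => if k = i then 2 * D - Δ else if k = j then 2 * D - 2 * Δ else 0
  have hμi : μ i = 2 * D - Δ := if_pos rfl
  have hμj : μ j = 2 * D - 2 * Δ := by simp [μ, hji]
  have hμk k (hki : k ≠ i) (hkj : k ≠ j) : μ k = 0 := by simp [μ, hki, hkj]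
  have hμ k : 0 ≤ μ k ∧ μ k ≤ 2 * D - Δ := by
    by_cases hki : k = i
    · rw [hki, hμi]; constructor <;> linarith
    · by_cases hkj : k = j
      · rw [hkj, hμj]; constructor <;> linarith
      · rw [hμk k hki hkj]; constructor <;> linarith
  have hgap k (hk : k ≠ i) : Δ ≤ μ i - μ k := by
    by_cases hkj : k = j
    · rw [hkj, hμi, hμj]; linarith
    · rw [hμi, hμk k hk hkj]; linarith
  have hbest k (hk : k ≠ i) : μ k < μ i := by linarith [hgap k hk]
  have hgap' (l k : Fin K) (hk : k ≠ l) :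
      Δ ≤ Function.update μ l (2 * D) l - Function.update μ l (2 * D) k := by
    rw [Function.update_self, Function.update_of_ne hk]
    linarith [(hμ k).2]
  have hbest' (l k : Fin K) (hk : k ≠ l) :
      Function.update μ l (2 * D) k < Function.update μ l (2 * D) l := by
    linarith [hgap' l k hk]
  have hsum : ∑ k ∈ univ.erase i, ((μ i - μ k) ^ 2)⁻¹ ≤ H := by
    have hjm : j ∈ univ.erase i := by simpa using hji
    have hcard : (((univ.erase i).erase j).card : ℝ) = K - 2 := by
      rw [card_erase_of_mem hjm, Nat.cast_sub (card_pos.2 ⟨j, hjm⟩), card_erase_fin hK]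
      push_cast; ring
    have hrest : ∑ k ∈ (univ.erase i).erase j, ((μ i - μ k) ^ 2)⁻¹ =
        (K - 2) * ((2 * D - Δ) ^ 2)⁻¹ := by
      rw [← hcard, ← nsmul_eq_mul]
      refine sum_eq_card_nsmul fun k hk => ?_
      simp only [mem_erase, mem_univ, and_true] at hk
      rw [hμi, hμk k hk.2 hk.1, sub_zero]
    rw [← add_sum_erase _ _ hjm, hrest, hμi, hμj,
      show (K : ℝ) - 2 = H * D ^ 2 - 1 by rw [hHD]; ring]
    have hd : 0 < 2 * D - Δ := by linarith
    have key : (2 * D - Δ) ^ 2 + (H * D ^ 2 - 1) * Δ ^ 2 ≤ H * (Δ ^ 2 * (2 * D - Δ) ^ 2) := by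
      -- The difference of the two sides of `key` factors as (D - Δ)(HΔ²(3D - Δ) - 4D).
      have h1 : 4 * (3 * D - Δ) ≤ H * Δ ^ 2 * (3 * D - Δ) :=
        mul_le_mul_of_nonneg_right hHΔ (by linarith)
      have h2 : 0 ≤ (D - Δ) * (H * Δ ^ 2 * (3 * D - Δ) - 4 * D) :=
        mul_nonneg (by linarith) (by linarith)
      linarith
    rw [show 2 * D - Δ - (2 * D - 2 * Δ) = Δ by ring]
    calc (Δ ^ 2)⁻¹ + (H * D ^ 2 - 1) * ((2 * D - Δ) ^ 2)⁻¹
        = ((2 * D - Δ) ^ 2 + (H * D ^ 2 - 1) * Δ ^ 2) / (Δ ^ 2 * (2 * D - Δ) ^ 2) := by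
          rw [add_div, div_mul_cancel_right₀ (by positivity), mul_comm (Δ ^ 2),
            mul_div_mul_right _ _ (by positivity), div_eq_mul_inv (H * D ^ 2 - 1)]
      _ ≤ H := by rw [div_le_iff₀ (by positivity)]; exact key
  have hsum' (l : Fin K) (hl : l ≠ i) : ∑ k ∈ univ.erase l,
      ((Function.update μ l (2 * D) l - Function.update μ l (2 * D) k) ^ 2)⁻¹ ≤ H := by
    -- Adding (2D)⁻² for every arm is crude, but the total is at most H/4 + H/16 + H/4.
    have hterm k (hk : k ∈ univ.erase l) :
        ((Function.update μ l (2 * D) l - Function.update μ l (2 * D) k) ^ 2)⁻¹ ≤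
          (if k = i then (Δ ^ 2)⁻¹ else 0) + (if k = j then ((2 * Δ) ^ 2)⁻¹ else 0) +
            ((2 * D) ^ 2)⁻¹ := by
      have hkl : k ≠ l := by simpa using hk
      rw [Function.update_self, Function.update_of_ne hkl]
      by_cases hki : k = i
      · have : i ≠ j := hji.symm
        rw [hki, hμi, show 2 * D - (2 * D - Δ) = Δ by ring, if_pos rfl, if_neg this]
        have : 0 ≤ ((2 * D) ^ 2)⁻¹ := by positivity
        linarith
      · by_cases hkj : k = j
        · rw [hkj, hμj, show 2 * D - (2 * D - 2 * Δ) = 2 * Δ by ring, if_neg hji, if_pos rfl]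
          have : 0 ≤ ((2 * D) ^ 2)⁻¹ := by positivity
          linarith
        · rw [hμk k hki hkj, if_neg hki, if_neg hkj]
          simp
    have hil : i ∈ univ.erase l := by simpa using hl.symm
    -- Only an inequality, since the term of arm j is absent if l = j.
    have hite : ∑ k ∈ univ.erase l, (if k = j then ((2 * Δ) ^ 2)⁻¹ else 0) ≤ ((2 * Δ) ^ 2)⁻¹ := by
      rw [sum_ite_eq']
      split_ifs
      · exact le_rfl
      · positivity
    refine (sum_le_sum hterm).trans ?_
    rw [sum_add_distrib, sum_add_distrib, sum_ite_eq', if_pos hil, sum_const, nsmul_eq_mul,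
      card_erase_fin hK, ← hHD]
    have h1 : H * D ^ 2 * ((2 * D) ^ 2)⁻¹ = H / 4 := by field_simp; norm_num
    have h2 : (Δ ^ 2)⁻¹ ≤ H / 4 := by
      rw [inv_le_iff_one_le_mul₀ (by positivity)]; linarith
    have h3 : ((2 * Δ) ^ 2)⁻¹ = (Δ ^ 2)⁻¹ / 4 := by field_simp; norm_num
    rw [h1]
    rw [h3] at hite ⊢
    linarith
  refine ofReal_hardness_le_iSup_risk_of_update
    (S := {ν ∈ modelsOfComplexity K σ B H | smallestGap ν = ENNReal.ofReal Δ})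
    (i := i) (top := 2 * D) (μ := μ) hσ hc hH hΔ.le
    ⟨gaussianModel_mem_modelsOfComplexity hσ (fun a => ⟨(hμ a).1, by linarith [(hμ a).2]⟩) hbest
      hsum, ?_⟩
    (fun k hk => by rw [gap_gaussianModel hbest]; exact hgap k hk)
    (fun l hl => ⟨gaussianModel_mem_modelsOfComplexity hσ (fun a => ?_) (hbest' l) (hsum' l hl), ?_⟩)
    (fun l hl k hk => by rw [gap_gaussianModel (hbest' l)]; exact hgap' l k hk)
    (fun l hl => by linarith [(hμ l).2])
    (div_four_le_sum_inv_sq hK hD hHD (fun k => (hμ k).1) fun k _ => by linarith [(hμ k).2]) π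
  · refine smallestGap_eq hΔ hji ?_ (by simpa only [mean_gaussianModel] using hgap)
    rw [mean_gaussianModel, mean_gaussianModel, hμi, hμj]; ring
  · by_cases ha : a = l
    · rw [ha, Function.update_self]; exact ⟨by positivity, hB⟩
    · rw [Function.update_of_ne ha]; exact ⟨(hμ a).1, by linarith [(hμ a).2]⟩
  -- Once arm l is raised to 2D, the former best arm i is second, at distance Δ.
  · refine smallestGap_eq (i := l) hΔ hl.symm ?_ (by simpa only [mean_gaussianModel] using hgap' l)
    rw [mean_gaussianModel, mean_gaussianModel, Function.update_self,
      Function.update_of_ne hl.symm, hμi]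
    ring

/-- With H = k/D² and Δ = D, the first case of `hardness` is A/(4D²) · (1 + log(D³/A)). It is
stationary in D where log(D³/A) = 1/2, that is D³ = √e A, which gives 3A/(8D²). -/
lemma hardness_optimum {σ c A D : ℝ} {k : ℝ} (hσ : 0 < σ) (hc : 0 < c) (hk : 0 < k)
    (hA : A = k * σ ^ 2 * c) (hD : 0 < D) (hD3 : D ^ 3 = √(Real.exp 1) * A) :
    hardness σ c (k / D ^ 2) D = 3 / 8 * (A / Real.exp 1) ^ (1 / 3 : ℝ) := by
  have hA0 : 0 < A := by rw [hA]; positivity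
  have hse : √(Real.exp 1) ^ 2 = Real.exp 1 := Real.sq_sqrt (Real.exp_pos _).le
  have hse0 : 0 < √(Real.exp 1) := Real.sqrt_pos.2 (Real.exp_pos _)
  have hse1 : 1 ≤ √(Real.exp 1) := Real.one_le_sqrt.2 (Real.one_le_exp zero_le_one)
  have hcond : σ ^ 2 * c * (k / D ^ 2) ≤ D := by
    rw [show σ ^ 2 * c * (k / D ^ 2) = A / D ^ 2 by rw [hA]; ring, div_le_iff₀ (by positivity),
      ← pow_succ', hD3]
    nlinarith
  have hlog : Real.log (Real.exp 1 * D / (σ ^ 2 * c * (k / D ^ 2))) = 3 / 2 := by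
    have : Real.exp 1 * D / (σ ^ 2 * c * (k / D ^ 2)) = Real.exp 1 * √(Real.exp 1) := by
      rw [show σ ^ 2 * c * (k / D ^ 2) = A / D ^ 2 by rw [hA]; ring]
      rw [div_div_eq_mul_div, mul_assoc, ← pow_succ', hD3]
      field_simp
    rw [this, Real.log_mul (Real.exp_pos _).ne' hse0.ne', Real.log_sqrt (Real.exp_pos _).le,
      Real.log_exp]
    norm_num
  have hroot : (A / Real.exp 1) ^ (1 / 3 : ℝ) = A / D ^ 2 := by
    have : A / Real.exp 1 = (A / D ^ 2) ^ 3 := by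
      rw [div_pow, ← pow_mul, show D ^ (2 * 3) = (D ^ 3) ^ 2 by ring, hD3, mul_pow, hse]
      field_simp
    rw [this, show (1 / 3 : ℝ) = ((3 : ℕ) : ℝ)⁻¹ by norm_num,
      Real.pow_rpow_inv_natCast (by positivity) (by norm_num)]
  rw [hardness, if_pos hcond, hlog, hroot, hA]
  ring

end BanditRisk

end

theorem theorem3 (K : ℕ) (hK : 2 ≤ K) (σ c B : ℝ) (hσ : 0 < σ) (hc : 0 < c) :
    -- worst case over the models of complexity at most `H`
    (∀ H Δ₂ : ℝ, 0 < H → 0 ≤ Δ₂ → Δ₂ ≤ √(((K : ℝ) - 1) / H) →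
      2 * √(((K : ℝ) - 1) / H) ≤ B →
      ∀ π : BanditRisk.Policy K,
        ENNReal.ofReal (BanditRisk.hardness σ c H Δ₂) ≤
          ⨆ ν ∈ BanditRisk.modelsOfComplexity K σ B H, BanditRisk.risk c π ν) ∧
    -- the same with the smallest gap fixed to `Δ₂`, if `H` and `Δ₂` occur together in some model
    (∀ H Δ₂ : ℝ, 0 < H → 0 ≤ Δ₂ →
      (∃ ν₀ ∈ BanditRisk.models K σ B, BanditRisk.complexity ν₀ = ENNReal.ofReal H ∧
        BanditRisk.smallestGap ν₀ = ENNReal.ofReal Δ₂) →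
      2 * √(((K : ℝ) - 1) / H) ≤ B →
      ∀ π : BanditRisk.Policy K,
        ENNReal.ofReal (BanditRisk.hardness σ c H Δ₂) ≤
          ⨆ ν ∈ {ν ∈ BanditRisk.modelsOfComplexity K σ B H |
            BanditRisk.smallestGap ν = ENNReal.ofReal Δ₂}, BanditRisk.risk c π ν) ∧
    -- minimax bound over all models
    (2 * (√(Real.exp 1) * ((K : ℝ) - 1) * σ ^ 2 * c) ^ (1 / 3 : ℝ) ≤ B →
      ∀ π : BanditRisk.Policy K,
        ENNReal.ofReal (3 / 8 * (((K : ℝ) - 1) * σ ^ 2 * c / Real.exp 1) ^ (1 / 3 : ℝ)) ≤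
          ⨆ ν ∈ BanditRisk.models K σ B, BanditRisk.risk c π ν) := by
  have hK1 : (0 : ℝ) < K - 1 := by
    have : (2 : ℝ) ≤ K := by exact_mod_cast hK
    linarith
  have hsq {H : ℝ} (hH : 0 < H) : H * √(((K : ℝ) - 1) / H) ^ 2 = K - 1 := by
    rw [Real.sq_sqrt (by positivity)]
    field_simp
  refine ⟨fun H Δ₂ hH hΔ hΔD hB π => ?_, fun H Δ₂ hH hΔ hν hB π => ?_, fun hB π => ?_⟩
  · exact BanditRisk.ofReal_hardness_le_iSup_modelsOfComplexity hK hσ hc hH hΔ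
      (Real.sqrt_pos.2 (by positivity)) (hsq hH) hΔD hB π
  · obtain ⟨ν₀, hν₀, hcomp, hsmall⟩ := hν
    obtain ⟨i, j, hji, hΔ0, hj, hgap, hsum⟩ :=
      BanditRisk.exists_best_of_complexity hK hH hΔ hcomp hsmall
    rcases le_total (H * Δ₂ ^ 2) 4 with h4 | h4
    · exact BanditRisk.ofReal_hardness_le_iSup_smallestGap_of_le
        (μ := fun k => BanditRisk.mean (ν₀ k)) hσ hc hH hΔ0 (fun k => (hν₀ k).2) hji hj hgap hsum
        h4 π
    · refine BanditRisk.ofReal_hardness_le_iSup_smallestGap_of_ge hK hσ hc hH hΔ0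
        (Real.sqrt_pos.2 (by positivity)) (hsq hH) ?_ hB h4 hji π
      -- Each of the K - 1 gaps is at least Δ₂, so H ≤ (K-1)/Δ₂².
      refine Real.le_sqrt_of_sq_le ?_
      rw [le_div_iff₀ hH, mul_comm, ← le_div_iff₀ (by positivity), ← hsum, div_eq_mul_inv,
        ← BanditRisk.card_erase_fin hK i, ← nsmul_eq_mul]
      refine Finset.sum_le_card_nsmul _ _ _ fun k hk => ?_
      have := hgap k (by simpa using hk)
      gcongr
  · set D : ℝ := (√(Real.exp 1) * ((K : ℝ) - 1) * σ ^ 2 * c) ^ (1 / 3 : ℝ) with hDdef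
    have hse0 : 0 < √(Real.exp 1) := Real.sqrt_pos.2 (Real.exp_pos _)
    have hpos : 0 < √(Real.exp 1) * ((K : ℝ) - 1) * σ ^ 2 * c := by positivity
    have hD : 0 < D := Real.rpow_pos_of_pos hpos _
    have hD3 : D ^ 3 = √(Real.exp 1) * (((K : ℝ) - 1) * σ ^ 2 * c) := by
      rw [hDdef, show (1 / 3 : ℝ) = ((3 : ℕ) : ℝ)⁻¹ by norm_num,
        Real.rpow_inv_natCast_pow hpos.le (by norm_num)]
      ring
    rw [← BanditRisk.hardness_optimum hσ hc hK1 rfl hD hD3]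
    refine (BanditRisk.ofReal_hardness_le_iSup_modelsOfComplexity (B := B) hK hσ hc
      (by positivity) hD.le hD (by field_simp) le_rfl hB π).trans ?_
    exact biSup_mono fun ν hν => hν.1
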